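/- Let $k\in\mathbb R$ with $e^k+e^{-k}\in\mathbb Z\setminus\{2\}$, and let $G_k$ be the Lie group of all matrices $$\begin{pmatrix} e^{kz}&0&0&x\\ 0&e^{-kz}&0&y\\ 0&0&1&z\\ 0&0&0&1\end{pmatrix},\qquad x,y,z\in\mathbb R .$$ Let $\Gamma_k\subset G_k$ be a discrete subgroup such that $N_k=G_k/\Gamma_k$ is compact, and let $\alpha,\beta,\gamma$ be the $1$-forms on $N_k$ whose pull-backs to $G_k$ are the right invariant forms $dx-kx\,dz$, $dy+ky\,dz$, $dz$. Let $n\neq 0$ be an integer, $\lambda$ a real number, and $\pi:M_{n,k}\to N_k$ a smooth principal $S^1$-bundle ($S^1=\mathbb R/\mathbb Z$) with Chern class $n\lambda[\alpha\wedge\beta]$, with a connection form $\eta$ such that $d\eta=n\lambda\,\pi^*(\alpha\wedge\beta)$ and $\eta(T)=1$ for the vector field $T$ generating the $S^1$-action. Denote the pull-backs of $\alpha,\beta,\gamma$ to $M_{n,k}$ by the same letters. For real numbers $t_1,t_2,t_3$ with $t_1t_2\neq0$ and $t_1t_2\neq nk\lambda t_3^2$ let $$\Omega_{(t_1,t_2,t_3)}=t_1\,\alpha\wedge\eta+t_2\,\beta\wedge\gamma+t_3\,(n\lambda\,\alpha\wedge\beta-k\,\gamma\wedge\eta),$$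 and for real numbers $s_1,s_2,s_3$ with $s_1s_2\neq0$ and $s_1s_2\neq nk\lambda s_3^2$ let $$\Omega'_{(s_1,s_2,s_3)}=s_1\,\beta\wedge\eta+s_2\,\alpha\wedge\gamma+s_3\,(n\lambda\,\alpha\wedge\beta+k\,\gamma\wedge\eta).$$ Then no (finite-dimensional, second countable) Lie group $G$ has a smooth transitive action on $M_{n,k}$ that preserves one of the forms $\Omega_{(t_1,t_2,t_3)}$ (that is, $g^*\Omega_{(t_1,t_2,t_3)}=\Omega_{(t_1,t_2,t_3)}$ for all $g\in G$), and none has a smooth transitive action on $M_{n,k}$ that preserves one of the forms $\Omega'_{(s_1,s_2,s_3)}$. -/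

import Mathlib

open scoped Manifold ContDiff

namespace ACFM

noncomputable section

/-! ### Differential forms on manifolds without boundary -/

/-- `m`-dimensional Euclidean space, the model of `m`-manifolds. -/
abbrev E (m : ℕ) : Type := EuclideanSpace ℝ (Fin m)

/-- (Not necessarily smooth) differential `r`-forms on an `m`-manifold `M`. Addition and
multiplication by real numbers are pointwise. -/
abbrev DForm (m r : ℕ) (M : Type*) [TopologicalSpace M] [ChartedSpace (E m) M] : Type _ :=
  ∀ p : M, TangentSpace (𝓡 m) p [⋀^Fin r]→L[ℝ] ℝ

section Forms

variable {m m' r : ℕ} {M : Type*} [TopologicalSpace M] [ChartedSpace (E m) M]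
  {M' : Type*} [TopologicalSpace M'] [ChartedSpace (E m') M']

/-- The pull-back `f^* θ` of a form. -/
def pullback (f : M → M') (θ : DForm m' r M') : DForm m r M := fun p =>
  (θ (f p)).compContinuousLinearMap (mfderiv (𝓡 m) (𝓡 m') f p)

theorem alt_one_add {V : Type*} [AddCommGroup V] [Module ℝ V] [TopologicalSpace V]
    (a : V [⋀^Fin 1]→L[ℝ] ℝ) (x y : V) :
    a (fun _ => x + y) = a (fun _ => x) + a (fun _ => y) := by
  have hu : ∀ z : V, Function.update (fun _ : Fin 1 => (0 : V)) 0 z = fun _ => z := fun z => by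
    ext i
    fin_cases i
    simp
  have h := a.map_update_add (fun _ => 0) 0 x y
  rwa [hu, hu, hu] at h

theorem alt_one_smul {V : Type*} [AddCommGroup V] [Module ℝ V] [TopologicalSpace V]
    (a : V [⋀^Fin 1]→L[ℝ] ℝ) (c : ℝ) (x : V) :
    a (fun _ => c • x) = c * a (fun _ => x) := by
  have hu : ∀ z : V, Function.update (fun _ : Fin 1 => (0 : V)) 0 z = fun _ => z := fun z => by
    ext i
    fin_cases i
    simp
  have h := a.map_update_smul (fun _ => 0) 0 c x
  rwa [hu, hu, smul_eq_mul] at h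

/-- The wedge product of two alternating `1`-forms on a vector space:
`(a ∧ b)(v₀, v₁) = a(v₀) b(v₁) - a(v₁) b(v₀)`. -/
def wedgeAlt {V : Type*} [AddCommGroup V] [Module ℝ V] [TopologicalSpace V]
    (a b : V [⋀^Fin 1]→L[ℝ] ℝ) : V [⋀^Fin 2]→L[ℝ] ℝ where
  toFun v := a (fun _ => v 0) * b (fun _ => v 1) - a (fun _ => v 1) * b (fun _ => v 0)
  map_update_add' := by
    intro inst v i x y
    rw [Subsingleton.elim inst (instDecidableEqFin 2)]
    fin_cases i <;> simp [alt_one_add] <;> ring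
  map_update_smul' := by
    intro inst v i c x
    rw [Subsingleton.elim inst (instDecidableEqFin 2)]
    fin_cases i <;> simp [alt_one_smul] <;> ring
  cont := by
    have h : ∀ i : Fin 2, Continuous fun v : Fin 2 → V => (fun _ : Fin 1 => v i) :=
      fun i => continuous_pi fun _ => continuous_apply i
    exact ((a.cont.comp (h 0)).mul (b.cont.comp (h 1))).sub
      ((a.cont.comp (h 1)).mul (b.cont.comp (h 0)))
  map_eq_zero_of_eq' := by
    intro v i j hv hij
    have h : v 0 = v 1 := by
      fin_cases i <;> fin_cases j <;> simp_all
    simp only [h]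
    ring

/-- The wedge product of two `1`-forms. -/
def wedge (a b : DForm m 1 M) : DForm m 2 M := fun p => wedgeAlt (a p) (b p)

/-- The expression of a form in the chart at `p`, a form on (the target of the chart in)
Euclidean space. -/
def chartRep (θ : DForm m r M) (p : M) : E m → E m [⋀^Fin r]→L[ℝ] ℝ :=
  pullback (M := E m) ((chartAt (E m) p).symm) θ

/-- Smoothness of a form: its expressions in charts are smooth. -/
def IsSmoothForm (θ : DForm m r M) : Prop :=
  ∀ p : M, ContDiffOn ℝ ∞ (chartRep θ p) (chartAt (E m) p).target

/-- The exterior derivative of a form, computed at each point in the chart at this point. -/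
def extD (θ : DForm m r M) : DForm m (r + 1) M := fun p =>
  pullback (M' := E m) (chartAt (E m) p) (extDeriv (chartRep θ p)) p

end Forms

/-! ### The group `G_k` -/

/-- The matrix with coordinates `(x, y, z) = (v 0, v 1, v 2)`. -/
def solvMatrix (k : ℝ) (v : E 3) : Matrix (Fin 4) (Fin 4) ℝ :=
  !![Real.exp (k * v 2), 0, 0, v 0;
     0, Real.exp (-(k * v 2)), 0, v 1;
     0, 0, 1, v 2;
     0, 0, 0, 1]

/-- The product of `G_k` in coordinates. -/
def mulCoord (k : ℝ) (v w : E 3) : E 3 :=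
  !₂[Real.exp (k * v 2) * w 0 + v 0, Real.exp (-(k * v 2)) * w 1 + v 1, w 2 + v 2]

/-- The inverse of `G_k` in coordinates. -/
def invCoord (k : ℝ) (v : E 3) : E 3 :=
  !₂[-(Real.exp (-(k * v 2)) * v 0), -(Real.exp (k * v 2) * v 1), -v 2]

theorem solvMatrix_mul (k : ℝ) (v w : E 3) :
    solvMatrix k v * solvMatrix k w = solvMatrix k (mulCoord k v w) := by
  ext i j
  fin_cases i <;> fin_cases j <;>
    simp [solvMatrix, mulCoord, Matrix.mul_apply, Fin.sum_univ_four, ← Real.exp_add] <;> ring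

theorem solvMatrix_zero (k : ℝ) : solvMatrix k 0 = 1 := by
  ext i j
  fin_cases i <;> fin_cases j <;> simp [solvMatrix]

theorem mulCoord_invCoord (k : ℝ) (v : E 3) : mulCoord k v (invCoord k v) = 0 := by
  ext i
  fin_cases i <;> simp [mulCoord, invCoord, ← mul_assoc, ← Real.exp_add]

theorem invCoord_mulCoord (k : ℝ) (v : E 3) : mulCoord k (invCoord k v) v = 0 := by
  ext i
  fin_cases i <;> simp [mulCoord, invCoord]

/-- The element of `GL(4, ℝ)` with coordinates `(x, y, z) = (v 0, v 1, v 2)`. -/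
def solvUnit (k : ℝ) (v : E 3) : GL (Fin 4) ℝ where
  val := solvMatrix k v
  inv := solvMatrix k (invCoord k v)
  val_inv := by rw [solvMatrix_mul, mulCoord_invCoord, solvMatrix_zero]
  inv_val := by rw [solvMatrix_mul, invCoord_mulCoord, solvMatrix_zero]

theorem solvUnit_mul (k : ℝ) (v w : E 3) :
    solvUnit k v * solvUnit k w = solvUnit k (mulCoord k v w) :=
  Units.ext (solvMatrix_mul k v w)

/-- The group `G_k` of all matrices `solvMatrix k v`, a (closed) subgroup of `GL(4, ℝ)`, with the
subspace topology. -/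
def Gk (k : ℝ) : Subgroup (GL (Fin 4) ℝ) where
  carrier := {g | ∃ v : E 3, (g : Matrix (Fin 4) (Fin 4) ℝ) = solvMatrix k v}
  mul_mem' := by
    rintro a b ⟨v, hv⟩ ⟨w, hw⟩
    exact ⟨mulCoord k v w, by rw [Units.val_mul, hv, hw, solvMatrix_mul]⟩
  one_mem' := ⟨0, by rw [solvMatrix_zero, Units.val_one]⟩
  inv_mem' := by
    rintro a ⟨v, hv⟩
    have : a = solvUnit k v := Units.ext hv
    exact ⟨invCoord k v, by rw [this]; rfl⟩

/-- The element of `G_k` with coordinates `(x, y, z) = (v 0, v 1, v 2)`. -/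
def ofCoord (k : ℝ) (v : E 3) : Gk k := ⟨solvUnit k v, v, rfl⟩

/-- The coordinates `(x, y, z)` of an element of `G_k`. -/
def coord (k : ℝ) (g : Gk k) : E 3 :=
  !₂[g.1.1 0 3, g.1.1 1 3,
    g.1.1 2 3]

theorem coord_ofCoord (k : ℝ) (v : E 3) : coord k (ofCoord k v) = v := by
  ext i
  fin_cases i <;> simp [coord, ofCoord, solvUnit, solvMatrix]

theorem ofCoord_coord (k : ℝ) (g : Gk k) : ofCoord k (coord k g) = g := by
  obtain ⟨g, v, hv⟩ := g
  have h : (⟨g, v, hv⟩ : Gk k) = ofCoord k v := Subtype.ext (Units.ext hv)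
  rw [h, coord_ofCoord]

theorem ofCoord_mul (k : ℝ) (v w : E 3) :
    ofCoord k v * ofCoord k w = ofCoord k (mulCoord k v w) :=
  Subtype.ext (solvUnit_mul k v w)

theorem continuous_solvMatrix (k : ℝ) : Continuous (solvMatrix k) := by
  refine continuous_matrix fun i j => ?_
  fin_cases i <;> fin_cases j <;> simp [solvMatrix] <;> fun_prop

theorem continuous_invCoord (k : ℝ) : Continuous (invCoord k) := by
  unfold invCoord
  fun_prop

/-- The global chart of `G_k` given by the coordinates `(x, y, z)`. -/
def coordHomeo (k : ℝ) : E 3 ≃ₜ Gk k where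
  toFun := ofCoord k
  invFun := coord k
  left_inv := coord_ofCoord k
  right_inv := ofCoord_coord k
  continuous_toFun := by
    refine Continuous.subtype_mk ?_ _
    exact Units.continuous_iff.2 ⟨continuous_solvMatrix k,
      (continuous_solvMatrix k).comp (continuous_invCoord k)⟩
  continuous_invFun := by
    have h : ∀ i j, Continuous fun g : Gk k => g.1.1 i j := fun i j =>
      (Units.continuous_val.comp continuous_subtype_val : Continuous fun g : Gk k =>
        (g.1.1 : Matrix (Fin 4) (Fin 4) ℝ)).matrix_elem i j
    unfold coord
    have := h 0 3
    have := h 1 3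
    have := h 2 3
    fun_prop

/-! ### The quotient `N_k = G_k / Γ` and its smooth structure -/

section Quotient

variable {k : ℝ} (Γ : Subgroup (Gk k))

/-- The quotient map `G_k → G_k / Γ`, in coordinates on `G_k`. -/
def proj (v : E 3) : Gk k ⧸ Γ := QuotientGroup.mk (ofCoord k v)

theorem proj_surjective : Function.Surjective (proj Γ) := fun q => by
  obtain ⟨g, rfl⟩ := QuotientGroup.mk_surjective q
  exact ⟨coord k g, by rw [proj, ofCoord_coord]⟩

variable [hΓ : DiscreteTopology Γ]

theorem isLocalHomeomorph_proj : IsLocalHomeomorph (proj Γ) :=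
  (Γ.isQuotientCoveringMap (isDiscrete_iff_discreteTopology.2 hΓ)).isCoveringMap.isLocalHomeomorph.comp
    (coordHomeo k).isLocalHomeomorph

theorem exists_chart (b : Gk k ⧸ Γ) : ∃ e : OpenPartialHomeomorph (Gk k ⧸ Γ) (E 3),
    b ∈ e.source ∧ ∀ v ∈ e.target, e.symm v = proj Γ v := by
  obtain ⟨v, rfl⟩ := proj_surjective Γ b
  obtain ⟨e, hv, he⟩ := isLocalHomeomorph_proj Γ v
  exact ⟨e.symm, by rw [he]; exact e.map_source hv, fun w _ => by simp [he]⟩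

/-- The smooth structure of `N_k = G_k / Γ`: the charts are the local inverses of the
quotient map (in the coordinates `(x, y, z)`). -/
instance : ChartedSpace (E 3) (Gk k ⧸ Γ) where
  atlas := {e | ∀ v ∈ e.target, e.symm v = proj Γ v}
  chartAt b := (exists_chart Γ b).choose
  mem_chart_source b := (exists_chart Γ b).choose_spec.1
  chart_mem_atlas b := (exists_chart Γ b).choose_spec.2

variable {Γ} in
/-- A continuous map that lifts the identity of `G_k / Γ` is locally a right translation. -/
theorem locally_translation {f : E 3 → E 3} {s : Set (E 3)} {v₀ : E 3} (hs : IsOpen s)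
    (hv₀ : v₀ ∈ s) (hf : ContinuousOn f s) (h : ∀ v ∈ s, proj Γ v = proj Γ (f v)) :
    ∃ w : E 3, f =ᶠ[nhds v₀] fun v => mulCoord k v w := by
  have hmem : ∀ v : s, (ofCoord k v)⁻¹ * ofCoord k (f v) ∈ Γ := fun v =>
    QuotientGroup.eq.1 (h v v.2)
  let c : s → Γ := fun v => ⟨(ofCoord k v)⁻¹ * ofCoord k (f v), hmem v⟩
  have hA : Continuous (ofCoord k) := (coordHomeo k).continuous
  have hc : Continuous c := Continuous.subtype_mk
    ((hA.comp continuous_subtype_val).inv.mul (hA.comp (continuousOn_iff_continuous_domRestrict.1 hf))) _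
  have hopen : IsOpen (Subtype.val '' (c ⁻¹' {c ⟨v₀, hv₀⟩})) :=
    hs.isOpenMap_subtype_val _ ((isOpen_discrete _).preimage hc)
  refine ⟨coord k (c ⟨v₀, hv₀⟩ : Gk k), ?_⟩
  filter_upwards [hopen.mem_nhds ⟨⟨v₀, hv₀⟩, rfl, rfl⟩]
  rintro _ ⟨v, hv, rfl⟩
  have h1 : (ofCoord k v)⁻¹ * ofCoord k (f v) = (c ⟨v₀, hv₀⟩ : Gk k) :=
    congrArg Subtype.val (show c v = c ⟨v₀, hv₀⟩ from hv)
  have h2 : ofCoord k (f v) = ofCoord k (mulCoord k v (coord k (c ⟨v₀, hv₀⟩ : Gk k))) := by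
    rw [← ofCoord_mul, ofCoord_coord, ← h1, mul_inv_cancel_left]
  rw [← coord_ofCoord k (f v), h2, coord_ofCoord]

theorem contDiff_mulCoord (w : E 3) : ContDiff ℝ ∞ fun v => mulCoord k v w := by
  rw [contDiff_euclidean]
  intro i
  fin_cases i <;> simp [mulCoord] <;> fun_prop

instance : IsManifold (𝓡 3) ∞ (Gk k ⧸ Γ) := by
  refine isManifold_of_contDiffOn _ _ _ fun e e' he he' v₀ hv₀ => ?_
  have hs : IsOpen (e.symm ≫ₕ e').source := (e.symm ≫ₕ e').open_source
  have hv : v₀ ∈ (e.symm ≫ₕ e').source := hv₀.1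
  obtain ⟨w, hw⟩ := locally_translation (Γ := Γ) hs hv (e.symm ≫ₕ e').continuousOn fun v hv => by
    have h1 : v ∈ e.target := by simpa using hv.1
    have h2 : e.symm v ∈ e'.source := by simpa using hv.2
    rw [← he v h1]
    have := he' (e' (e.symm v)) (e'.map_source h2)
    rw [e'.left_inv h2] at this
    exact this
  exact ((contDiff_mulCoord w).contDiffAt.congr_of_eventuallyEq hw).contDiffWithinAt

/-- The quotient map `G_k → G_k / Γ` is smooth. -/
theorem contMDiff_proj : ContMDiff (𝓡 3) (𝓡 3) ∞ (proj Γ) := fun v => by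
  obtain ⟨e, hv, he⟩ := isLocalHomeomorph_proj Γ v
  have hmem : e.symm ∈ atlas (E 3) (Gk k ⧸ Γ) := fun w _ => by simp [he]
  have h := contMDiffOn_symm_of_mem_maximalAtlas (I := 𝓡 3) (n := ∞)
    (IsManifold.subset_maximalAtlas hmem)
  have h2 := h.contMDiffAt (e.symm.open_target.mem_nhds (by simpa using hv))
  simpa [he] using h2

/-- The form on `N_k = G_k / Γ` that a right invariant form `θ` on `G_k` (in the coordinates
`(x, y, z)`) descends to: its pull-back by local sections of `G_k → G_k / Γ`. -/
def descend {r : ℕ} (θ : DForm 3 r (E 3)) : DForm 3 r (Gk k ⧸ Γ) := fun b =>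
  pullback (M' := E 3) (chartAt (E 3) b) θ b

/-- `descend Γ θ` is the form on `G_k / Γ` whose pull-back to `G_k` is `θ`. -/
theorem pullback_descend {r : ℕ} (θ : DForm 3 r (E 3))
    (hθ : ∀ w : E 3, pullback (fun v : E 3 => mulCoord k v w) θ = θ) :
    pullback (proj Γ) (descend Γ θ) = θ := by
  funext v
  set e := chartAt (E 3) (proj Γ v) with he
  have hvs : proj Γ v ∈ e.source := mem_chart_source _ _
  have hat : e ∈ atlas (E 3) (Gk k ⧸ Γ) := chart_mem_atlas _ _
  have hs : IsOpen (proj Γ ⁻¹' e.source) := e.open_source.preimage (contMDiff_proj Γ).continuous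
  obtain ⟨w, hw⟩ := locally_translation (Γ := Γ) (f := e ∘ proj Γ) hs hvs
    (e.continuousOn.comp (contMDiff_proj Γ).continuous.continuousOn fun _ h => h) fun u hu => by
      have := hat (e (proj Γ u)) (e.map_source hu)
      rwa [e.left_inv hu] at this
  have h1 : MDifferentiableAt (𝓡 3) (𝓡 3) e (proj Γ v) :=
    mdifferentiableAt_atlas hat hvs
  have h2 : MDifferentiableAt (𝓡 3) (𝓡 3) (proj Γ) v :=
    (contMDiff_proj Γ).mdifferentiable (by simp) v
  have h3 : mfderiv (𝓡 3) (𝓡 3) (e ∘ proj Γ) v =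
      (mfderiv (𝓡 3) (𝓡 3) e (proj Γ v)).comp (mfderiv (𝓡 3) (𝓡 3) (proj Γ) v) :=
    mfderiv_comp v h1 h2
  have h4 : pullback (m := 3) (e ∘ proj Γ) θ v =
      pullback (m := 3) (fun v : E 3 => mulCoord k v w) θ v := by
    have h5 := hw.mfderiv_eq (I := 𝓡 3) (I' := 𝓡 3)
    have h6 : (e ∘ proj Γ) v = mulCoord k v w := hw.self_of_nhds
    ext x
    unfold pullback
    simp only [ContinuousAlternatingMap.compContinuousLinearMap_apply]
    rw [h5]
    exact congrArg (fun q : E 3 => (θ q : E 3 [⋀^Fin r]→L[ℝ] ℝ) _) h6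
  rw [hθ w] at h4
  rw [← h4]
  ext x
  unfold pullback descend pullback
  simp only [ContinuousAlternatingMap.compContinuousLinearMap_apply]
  rw [h3]
  rfl

end Quotient

/-- The right invariant form `dx - k x dz` on `G_k`. -/
def alphaCoord (k : ℝ) : DForm 3 1 (E 3) := fun v =>
  ContinuousAlternatingMap.ofSubsingleton ℝ (E 3) ℝ (0 : Fin 1)
    (EuclideanSpace.proj 0 - (k * v 0) • EuclideanSpace.proj 2)

/-- The right invariant form `dy + k y dz` on `G_k`. -/
def betaCoord (k : ℝ) : DForm 3 1 (E 3) := fun v =>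
  ContinuousAlternatingMap.ofSubsingleton ℝ (E 3) ℝ (0 : Fin 1)
    (EuclideanSpace.proj 1 + (k * v 1) • EuclideanSpace.proj 2)

/-- The right invariant form `dz` on `G_k`. -/
def gammaCoord : DForm 3 1 (E 3) := fun _ =>
  ContinuousAlternatingMap.ofSubsingleton ℝ (E 3) ℝ (0 : Fin 1) (EuclideanSpace.proj 2)

/-- The differential of a right translation of `G_k`. -/
theorem mfderiv_mulCoord (k : ℝ) (v w u : E 3) :
    (mfderiv (𝓡 3) (𝓡 3) (fun v : E 3 => mulCoord k v w) v : E 3 →L[ℝ] E 3) u =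
      !₂[k * u 2 * Real.exp (k * v 2) * w 0 + u 0,
        -(k * u 2) * Real.exp (-(k * v 2)) * w 1 + u 1, u 2] := by
  have hd : ∀ i : Fin 3, HasFDerivAt (fun v : E 3 => v i) (EuclideanSpace.proj i : E 3 →L[ℝ] ℝ) v :=
    fun i => (EuclideanSpace.proj i : E 3 →L[ℝ] ℝ).hasFDerivAt
  have hf : DifferentiableAt ℝ (fun v : E 3 => mulCoord k v w) v :=
    (contDiff_mulCoord w).differentiable (by simp) v
  have hc : ∀ i : Fin 3, fderiv ℝ (fun v : E 3 => mulCoord k v w) v u i =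
      fderiv ℝ (fun v : E 3 => mulCoord k v w i) v u := fun i => by
    have h := ((EuclideanSpace.proj i : E 3 →L[ℝ] ℝ).hasFDerivAt.comp v hf.hasFDerivAt).fderiv
    exact (DFunLike.congr_fun h u).symm
  rw [mfderiv_eq_fderiv]
  refine PiLp.ext fun i => ?_
  refine (hc i).trans ?_
  fin_cases i
  · have h := ((((hd 2).const_mul k).exp.mul_const (w 0)).add (hd 0)).fderiv
    refine (DFunLike.congr_fun h u).trans ?_
    simp
    ring
  · have h := ((((hd 2).const_mul k).neg.exp.mul_const (w 1)).add (hd 1)).fderiv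
    refine (DFunLike.congr_fun h u).trans ?_
    simp
    ring
  · have h := ((hd 2).const_add (w 2)).fderiv
    exact DFunLike.congr_fun h u

theorem alphaCoord_invariant (k : ℝ) (w : E 3) :
    pullback (fun v : E 3 => mulCoord k v w) (alphaCoord k) = alphaCoord k := by
  funext v
  ext x
  let y : E 3 := x 0
  refine (congrArg (fun q : E 3 => q 0 - k * (mulCoord k v w) 0 * q 2)
    (mfderiv_mulCoord k v w y)).trans ?_
  change _ = y 0 - k * v 0 * y 2
  simp [mulCoord]
  ring

theorem betaCoord_invariant (k : ℝ) (w : E 3) :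
    pullback (fun v : E 3 => mulCoord k v w) (betaCoord k) = betaCoord k := by
  funext v
  ext x
  let y : E 3 := x 0
  refine (congrArg (fun q : E 3 => q 1 + k * (mulCoord k v w) 1 * q 2)
    (mfderiv_mulCoord k v w y)).trans ?_
  change _ = y 1 + k * v 1 * y 2
  simp [mulCoord]
  ring

theorem gammaCoord_invariant (k : ℝ) (w : E 3) :
    pullback (fun v : E 3 => mulCoord k v w) gammaCoord = gammaCoord := by
  funext v
  ext x
  refine (congrArg (fun q : E 3 => q 2) (mfderiv_mulCoord k v w (x 0))).trans ?_
  rfl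

section Quotient

variable {k : ℝ} (Γ : Subgroup (Gk k)) [DiscreteTopology Γ]

/-- The form `α` on `N_k = G_k / Γ`, with pull-back `dx - k x dz` to `G_k`. -/
def alpha : DForm 3 1 (Gk k ⧸ Γ) := descend Γ (alphaCoord k)

/-- The form `β` on `N_k = G_k / Γ`, with pull-back `dy + k y dz` to `G_k`. -/
def beta : DForm 3 1 (Gk k ⧸ Γ) := descend Γ (betaCoord k)

/-- The form `γ` on `N_k = G_k / Γ`, with pull-back `dz` to `G_k`. -/
def gamma : DForm 3 1 (Gk k ⧸ Γ) := descend Γ gammaCoord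

theorem pullback_alpha : pullback (proj Γ) (alpha Γ) = alphaCoord k :=
  pullback_descend Γ _ (alphaCoord_invariant k)

theorem pullback_beta : pullback (proj Γ) (beta Γ) = betaCoord k :=
  pullback_descend Γ _ (betaCoord_invariant k)

theorem pullback_gamma : pullback (proj Γ) (gamma Γ) = gammaCoord :=
  pullback_descend Γ _ (gammaCoord_invariant k)

end Quotient

/-! ### Principal circle bundles and connections -/

section Bundle

variable {M : Type*} [TopologicalSpace M] [ChartedSpace (E 4) M] [MulAction Circle M]
  {N : Type*} [TopologicalSpace N] [ChartedSpace (E 3) N]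

/-- `π : M → N` is a smooth principal `S¹`-bundle (with `M` of dimension `4` and `N` of
dimension `3`) for the given action of `S¹` on `M`: there are smooth equivariant local
trivializations `π⁻¹(U) ≃ U × S¹`. -/
structure IsPrincipalCircleBundle (π : M → N) : Prop where
  map_smul : ∀ (c : Circle) (p : M), π (c • p) = π p
  locally_trivial : ∀ b : N, ∃ e : Bundle.Trivialization Circle π, b ∈ e.baseSet ∧
    ContMDiffOn (𝓡 4) ((𝓡 3).prod (𝓡 1)) ∞ e e.source ∧
    ContMDiffOn ((𝓡 3).prod (𝓡 1)) (𝓡 4) ∞ e.toOpenPartialHomeomorph.symm e.target ∧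
    ∀ (c : Circle), ∀ p ∈ e.source, e (c • p) = ((e p).1, c * (e p).2)

/-- `η` is a (real valued) connection form for the action of `S¹ = ℝ/ℤ` on `M`: a smooth
invariant `1`-form which is `1` on the vector field generating the action
`t ↦ exp(2πit) • p`. (So the Chern class of the bundle is that of the closed form on the base
with pull-back `dη`.) -/
structure IsConnectionForm (η : DForm 4 1 M) : Prop where
  smooth : IsSmoothForm η
  invariant : ∀ c : Circle, pullback (fun p : M => c • p) η = η
  vertical : ∀ p : M, let orbit : ℝ → M := fun t => Circle.exp (2 * Real.pi * t) • p
    η (orbit 0) (fun _ => mfderiv 𝓘(ℝ, ℝ) (𝓡 4) orbit 0 (1 : ℝ)) = 1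

end Bundle

/-! ### The forms on `M_{n,k}` -/

section Omega

variable {k : ℝ} (Γ : Subgroup (Gk k)) [DiscreteTopology Γ]
  {M : Type*} [TopologicalSpace M] [ChartedSpace (E 4) M]

/-- `Ω_{(t₁,t₂,t₃)} = t₁ α∧η + t₂ β∧γ + t₃ (nλ α∧β - k γ∧η)`, where `α, β, γ` also denote the
pull-backs under `π`. -/
def OmegaT (n : ℤ) (lam : ℝ) (π : M → Gk k ⧸ Γ) (η : DForm 4 1 M) (t₁ t₂ t₃ : ℝ) :
    DForm 4 2 M :=
  let α : DForm 4 1 M := pullback π (alpha Γ)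
  let β : DForm 4 1 M := pullback π (beta Γ)
  let γ : DForm 4 1 M := pullback π (gamma Γ)
  t₁ • wedge α η + t₂ • wedge β γ + t₃ • ((n * lam) • wedge α β - k • wedge γ η)

/-- `Ω_{(s₁,s₂,s₃)} = s₁ β∧η + s₂ α∧γ + s₃ (nλ α∧β + k γ∧η)`, where `α, β, γ` also denote the
pull-backs under `π`. -/
def OmegaS (n : ℤ) (lam : ℝ) (π : M → Gk k ⧸ Γ) (η : DForm 4 1 M) (s₁ s₂ s₃ : ℝ) :
    DForm 4 2 M :=
  let α : DForm 4 1 M := pullback π (alpha Γ)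
  let β : DForm 4 1 M := pullback π (beta Γ)
  let γ : DForm 4 1 M := pullback π (gamma Γ)
  s₁ • wedge β η + s₂ • wedge α γ + s₃ • ((n * lam) • wedge α β + k • wedge γ η)

end Omega

end

end ACFM

/-! Write `a, b, c, e` for `α, β, γ, η` on `M` and `r = nλ`. The structure equations `da = -k a∧c`,
`db = k b∧c`, `dc = 0`, `de = r a∧b` give `dΩ = k c∧Ω`, so `Ω` is locally conformal symplectic with
Lee form `k c`. As `Ω` is nondegenerate and `k ≠ 0`, this equation determines `c`, so a map
preserving `Ω` preserves `c` (`IsLcsCoframe.pullback_lee`).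

Let `X` be the vector field of a curve through the identity of `G`. Since `c` is closed and
invariant, `d(c(X)) = 0`; the circle bundle `M` over the compact connected `N_k` is itself compact
and connected, so `c(X)` is a constant `y`. From `L_X Ω = 0` it follows that `d(i_X Ω) = -k y Ω` on
surfaces tangent to `ker c`. Apply Stokes to the surface swept out by the circle fibres over the
curve `s ↦ (s, 0, 0) Γ`: there `Ω` has constant density `t₁`, so the integral of `i_X Ω` over the
fibre at `s`, that is of `t₁ a(X) - k t₃ c(X)`, is affine in `s` with slope `-k y t₁`
(`IsLcsCoframe.integral_flowVal_sub`). It is also bounded, by compactness of `M`. Hence `y = 0`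
(`IsLcsCoframe.flowVal_lee_eq_zero`).

So `c` vanishes on all orbits, and a local primitive `z` of `c` is locally constant when read on `G`
through an orbit map. By transitivity and second countability of `G`, `z` takes only countably many
values (`countable_image_primitive`). But `c` comes from `dz`, whose local primitive takes all
values in a nonempty open set of reals (`exists_primitive_gamma`), a contradiction.

The forms `Ω'` arise from `Ω` by exchanging `a` with `b` and changing the signs of `k` and `r`; the
strip then runs in the `y`-direction. -/

namespace ACFM

open scoped Topology
open Filter Set

/-! ### Exterior derivatives of `1`-forms on normed spaces -/

section Calculus

variable {V : Type*} [NormedAddCommGroup V] [NormedSpace ℝ V]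
  {W : Type*} [NormedAddCommGroup W] [NormedSpace ℝ W]

/-- The derivative of the values of a pulled back `1`-form on a constant vector field. -/
theorem hasFDerivAt_oneForm_comp {φ : V → W} {x : V} (hφ : ContDiffAt ℝ 2 φ x)
    {θ : W → W →L[ℝ] ℝ} (hθ : DifferentiableAt ℝ θ (φ x)) (w : V) :
    ∃ D : V →L[ℝ] ℝ, HasFDerivAt (fun y => θ (φ y) (fderiv ℝ φ y w)) D x ∧
      ∀ v, D v = fderiv ℝ θ (φ x) (fderiv ℝ φ x v) (fderiv ℝ φ x w) +
        θ (φ x) (fderiv ℝ (fderiv ℝ φ) x v w) := by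
  have h1 : HasFDerivAt φ (fderiv ℝ φ x) x := (hφ.differentiableAt (by simp)).hasFDerivAt
  have h2 : HasFDerivAt (fderiv ℝ φ) (fderiv ℝ (fderiv ℝ φ) x) x :=
    ((hφ.fderiv_right (m := 1) (by norm_num)).differentiableAt (by simp)).hasFDerivAt
  have h3 := hθ.hasFDerivAt.comp x h1
  have h4 : HasFDerivAt (fun y => fderiv ℝ φ y w) _ x :=
    h2.clm_apply (hasFDerivAt_const w x)
  refine ⟨_, h3.clm_apply h4, fun v => ?_⟩
  simp
  ring

/-- The exterior derivative of a `1`-form commutes with pull-backs. -/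
theorem fderiv_oneForm_comp_sub {φ : V → W} {x : V} (hφ : ContDiffAt ℝ 2 φ x)
    {θ : W → W →L[ℝ] ℝ} (hθ : DifferentiableAt ℝ θ (φ x)) (v w : V) :
    fderiv ℝ (fun y => θ (φ y) (fderiv ℝ φ y w)) x v -
      fderiv ℝ (fun y => θ (φ y) (fderiv ℝ φ y v)) x w =
    fderiv ℝ θ (φ x) (fderiv ℝ φ x v) (fderiv ℝ φ x w) -
      fderiv ℝ θ (φ x) (fderiv ℝ φ x w) (fderiv ℝ φ x v) := by
  obtain ⟨D, hD, hDv⟩ := hasFDerivAt_oneForm_comp hφ hθ w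
  obtain ⟨D', hD', hDv'⟩ := hasFDerivAt_oneForm_comp hφ hθ v
  have hs : fderiv ℝ (fderiv ℝ φ) x v w = fderiv ℝ (fderiv ℝ φ) x w v :=
    (hφ.isSymmSndFDerivAt (by simp)) v w
  rw [hD.fderiv, hD'.fderiv, hDv, hDv', hs]
  ring

end Calculus

/-! ### Forms on manifolds, tested along maps from normed spaces -/

section Along

variable {V : Type*} [NormedAddCommGroup V] [NormedSpace ℝ V]
  {m m' : ℕ} {M : Type*} [TopologicalSpace M] [ChartedSpace (E m) M]
  {N : Type*} [TopologicalSpace N] [ChartedSpace (E m') N]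

/-- The differential of a map from a normed space to a manifold. -/
noncomputable def dAlong (F : V → M) (y : V) : V →L[ℝ] TangentSpace (𝓡 m) (F y) :=
  mfderiv 𝓘(ℝ, V) (𝓡 m) F y

/-- The value at `v` of the pull-back of a `1`-form by a map from a normed space. -/
noncomputable def along (F : V → M) (θ : DForm m 1 M) (v y : V) : ℝ :=
  θ (F y) (fun _ => dAlong F y v)

/-- `ζ` is the exterior derivative of the `1`-form `θ`, tested on all maps of class `C²` from
normed spaces. -/
def HasExtD (θ : DForm m 1 M) (ζ : DForm m 2 M) : Prop :=
  ∀ (V : Type) [NormedAddCommGroup V] [NormedSpace ℝ V] (F : V → M) (x : V),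
    ContMDiffAt 𝓘(ℝ, V) (𝓡 m) 2 F x →
      (∀ v, DifferentiableAt ℝ (along F θ v) x) ∧
      ∀ v w, fderiv ℝ (along F θ w) x v - fderiv ℝ (along F θ v) x w =
        ζ (F x) ![dAlong F x v, dAlong F x w]

theorem along_congr {F F' : V → M} {x : V} (h : F =ᶠ[𝓝 x] F') (θ : DForm m 1 M) (v : V) :
    along F θ v =ᶠ[𝓝 x] along F' θ v := by
  filter_upwards [h.eventuallyEq_nhds] with y hy
  have h1 : F y = F' y := hy.self_of_nhds
  have h2 := hy.mfderiv_eq (I := 𝓘(ℝ, V)) (I' := 𝓡 m)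
  simp only [along, dAlong]
  rw [h2]
  exact congrArg (fun q : M => (θ q : E m [⋀^Fin 1]→L[ℝ] ℝ) _) h1

theorem dAlong_comp {f : M → N} {F : V → M} {x : V} (hf : MDifferentiableAt (𝓡 m) (𝓡 m') f (F x))
    (hF : MDifferentiableAt 𝓘(ℝ, V) (𝓡 m) F x) (v : V) :
    dAlong (m := m') (f ∘ F) x v = mfderiv (𝓡 m) (𝓡 m') f (F x) (dAlong (m := m) F x v) := by
  unfold dAlong
  rw [mfderiv_comp x hf hF]
  rfl

theorem along_pullback {f : M → N} {F : V → M} {x : V}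
    (hf : MDifferentiableAt (𝓡 m) (𝓡 m') f (F x))
    (hF : MDifferentiableAt 𝓘(ℝ, V) (𝓡 m) F x) (θ : DForm m' 1 N) (v : V) :
    along F (pullback (m := m) f θ) v x = along (f ∘ F) θ v x := by
  simp only [along]
  rw [dAlong_comp (m := m) (m' := m') hf hF]
  rfl

end Along

section

variable {V : Type*} [NormedAddCommGroup V] [NormedSpace ℝ V]
  {m m' : ℕ} {M : Type*} [TopologicalSpace M] [ChartedSpace (E m) M]
  {N : Type*} [TopologicalSpace N] [ChartedSpace (E m') N]

theorem two_le_infty : (2 : WithTop ℕ∞) ≤ ∞ := WithTop.coe_le_coe.2 le_top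

theorem eventually_mdifferentiableAt [IsManifold (𝓡 m) ∞ M] {F : V → M} {x : V}
    (hF : ContMDiffAt 𝓘(ℝ, V) (𝓡 m) 2 F x) :
    ∀ᶠ y in 𝓝 x, MDifferentiableAt 𝓘(ℝ, V) (𝓡 m) F y := by
  have : IsManifold (𝓡 m) 2 M := IsManifold.of_le (n := ∞) two_le_infty
  filter_upwards [(contMDiffAt_iff_contMDiffAt_nhds (by simp)).1 hF] with y hy
  exact hy.mdifferentiableAt (by simp)

theorem eventually_along_pullback [IsManifold (𝓡 m) ∞ M] {f : M → N}
    (hf : MDifferentiable (𝓡 m) (𝓡 m') f) {F : V → M} {x : V}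
    (hF : ContMDiffAt 𝓘(ℝ, V) (𝓡 m) 2 F x) (θ : DForm m' 1 N) (v : V) :
    along F (pullback (m := m) f θ) v =ᶠ[𝓝 x] along (f ∘ F) θ v := by
  filter_upwards [eventually_mdifferentiableAt hF] with y hy
  exact along_pullback (hf _) hy θ v

/-- If `F` is a test map into the source, then `f ∘ F` is one into the target. Testing on all maps
of class `C²` thus makes naturality immediate, without charts. -/
theorem hasExtD_pullback [IsManifold (𝓡 m) ∞ M] {f : M → N} (hf : ContMDiff (𝓡 m) (𝓡 m') 2 f)
    {θ : DForm m' 1 N} {ζ : DForm m' 2 N} (h : HasExtD θ ζ) :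
    HasExtD (pullback (m := m) f θ) (pullback (m := m) f ζ) := by
  intro V _ _ F x hF
  have hfd : MDifferentiable (𝓡 m) (𝓡 m') f := hf.mdifferentiable (by simp)
  obtain ⟨h1, h2⟩ := h V (f ∘ F) x ((hf _).comp x hF)
  have he := eventually_along_pullback hfd hF θ
  refine ⟨fun v => (h1 v).congr_of_eventuallyEq (he v), fun v w => ?_⟩
  rw [(he v).fderiv_eq, (he w).fderiv_eq, h2]
  have hd := fun v => dAlong_comp (hfd (F x)) (hF.mdifferentiableAt (by simp)) v
  rw [hd, hd]
  change _ = ζ (f (F x)) (mfderiv (𝓡 m) (𝓡 m') f (F x) ∘ _)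
  congr 1
  ext i
  fin_cases i <;> rfl

/-- The linear functional underlying an alternating `1`-form. -/
noncomputable def toFunctional (m : ℕ) : (E m [⋀^Fin 1]→L[ℝ] ℝ) ≃L[ℝ] (E m →L[ℝ] ℝ) :=
  (ContinuousAlternatingMap.ofSubsingletonLIE (𝕜 := ℝ) (E := E m) (F := ℝ)
    (0 : Fin 1)).symm.toContinuousLinearEquiv

theorem toFunctional_apply (a : E m [⋀^Fin 1]→L[ℝ] ℝ) (v : E m) :
    toFunctional m a v = a (fun _ => v) := rfl

theorem along_modelSpace (φ : V → E m) (θ : DForm m 1 (E m)) (v y : V) :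
    along φ θ v y = toFunctional m (θ (φ y)) (fderiv ℝ φ y v) := by
  simp only [along, dAlong, mfderiv_eq_fderiv]
  rfl

theorem extDeriv_one_apply {θ : E m → E m [⋀^Fin 1]→L[ℝ] ℝ} {x : E m}
    (h : DifferentiableAt ℝ θ x) (v w : E m) :
    extDeriv θ x ![v, w] =
      fderiv ℝ (fun y => toFunctional m (θ y)) x v w -
        fderiv ℝ (fun y => toFunctional m (θ y)) x w v := by
  have h1 : HasFDerivAt (fun y => toFunctional m (θ y)) _ x :=
    (toFunctional m).hasFDerivAt.comp x h.hasFDerivAt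
  have e1 : (Fin.removeNth 0 ![v, w] : Fin 1 → E m) = fun _ => w := by
    ext i; fin_cases i; rfl
  have e2 : (Fin.removeNth 1 ![v, w] : Fin 1 → E m) = fun _ => v := by
    ext i; fin_cases i; rfl
  rw [extDeriv_apply h, h1.fderiv, Fin.sum_univ_two, e1, e2,
    fderiv_continuousAlternatingMap_apply_const_apply h,
    fderiv_continuousAlternatingMap_apply_const_apply h]
  simp [toFunctional_apply]
  ring

/-- The exterior derivative computed in the charts is the exterior derivative. -/
theorem IsSmoothForm.hasExtD [IsManifold (𝓡 m) ∞ M] {θ : DForm m 1 M} (hθ : IsSmoothForm θ) :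
    HasExtD θ (extD θ) := by
  intro V _ _ F x hF
  set e := chartAt (E m) (F x) with he
  have hsrc : F x ∈ e.source := mem_chart_source _ _
  set ψ : V → E m := e ∘ F with hψ
  have heC : ContMDiffAt (𝓡 m) (𝓡 m) ∞ e (F x) := contMDiffAt_of_mem_maximalAtlas
    (IsManifold.chart_mem_maximalAtlas _) hsrc
  have hψC : ContDiffAt ℝ 2 ψ x :=
    ((heC.of_le two_le_infty).comp x hF).contDiffAt
  have hnear : ∀ᶠ y in 𝓝 x, F y ∈ e.source :=
    hF.continuousAt.eventually (e.open_source.mem_nhds hsrc)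
  have hC : DifferentiableAt ℝ (chartRep θ (F x)) (ψ x) :=
    ((hθ (F x)).contDiffAt (e.open_target.mem_nhds (e.map_source hsrc))).differentiableAt
      (by simp)
  have hT : DifferentiableAt ℝ (fun y => toFunctional m (chartRep θ (F x) y)) (ψ x) :=
    (toFunctional m).differentiableAt.comp _ hC
  have hev : ∀ v, along F θ v =ᶠ[𝓝 x]
      fun y => toFunctional m (chartRep θ (F x) (ψ y)) (fderiv ℝ ψ y v) := by
    intro v
    -- Factoring `F` through the inverse chart replaces `θ` by its chart expression, to which the
    -- calculus on normed spaces applies.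
    have h1 : F =ᶠ[𝓝 x] e.symm ∘ ψ := by
      filter_upwards [hnear] with y hy
      simp [hψ, e.left_inv hy]
    filter_upwards [along_congr (m := m) h1 θ v, hnear,
      (hψC.eventually (by simp))] with y hy1 hy2 hy3
    rw [hy1, ← along_pullback (m := m) (m' := m) (f := e.symm) (F := ψ)]
    · exact along_modelSpace ψ (chartRep θ (F x)) v y
    · exact mdifferentiableAt_atlas_symm (chart_mem_atlas _ _) (e.map_source hy2)
    · exact (hy3.differentiableAt (by simp)).mdifferentiableAt
  have hdψ : ∀ v, fderiv ℝ ψ x v = mfderiv (𝓡 m) (𝓡 m) e (F x) (dAlong F x v) := by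
    intro v
    have := dAlong_comp (m := m) (m' := m) (f := e) (F := F) (x := x)
      (heC.mdifferentiableAt (by simp)) (hF.mdifferentiableAt (by simp)) v
    rw [← this]
    simp only [dAlong, mfderiv_eq_fderiv]
    rfl
  refine ⟨fun v => ?_, fun v w => ?_⟩
  · obtain ⟨D, hD, -⟩ := hasFDerivAt_oneForm_comp hψC hT v
    exact hD.differentiableAt.congr_of_eventuallyEq (hev v)
  · rw [(hev v).fderiv_eq, (hev w).fderiv_eq, fderiv_oneForm_comp_sub hψC hT,
      ← extDeriv_one_apply hC, hdψ, hdψ]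
    change _ = extDeriv (chartRep θ (F x)) (e (F x)) (mfderiv (𝓡 m) (𝓡 m) e (F x) ∘ _)
    congr 1
    ext i
    fin_cases i <;> rfl

end

/-! ### The structure equations of `α, β, γ` on `G_k / Γ` -/

section Quotient

variable {k : ℝ} {Γ : Subgroup (Gk k)} [DiscreteTopology Γ]
  {V : Type*} [NormedAddCommGroup V] [NormedSpace ℝ V]

/-- The charts of `G_k / Γ` are local inverses of `proj Γ`, so a map read in a chart is a local
lift. -/
theorem exists_local_lift {F : V → Gk k ⧸ Γ} {x : V}
    (hF : ContMDiffAt 𝓘(ℝ, V) (𝓡 3) 2 F x) :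
    ∃ φ : V → E 3, ContDiffAt ℝ 2 φ x ∧ F =ᶠ[𝓝 x] proj Γ ∘ φ := by
  set e := chartAt (E 3) (F x) with he
  have hsrc : F x ∈ e.source := mem_chart_source _ _
  have heC : ContMDiffAt (𝓡 3) (𝓡 3) ∞ e (F x) := contMDiffAt_of_mem_maximalAtlas
    (IsManifold.chart_mem_maximalAtlas _) hsrc
  refine ⟨e ∘ F, ((heC.of_le two_le_infty).comp x hF).contDiffAt, ?_⟩
  filter_upwards [hF.continuousAt.eventually (e.open_source.mem_nhds hsrc)] with y hy
  have hat : e ∈ atlas (E 3) (Gk k ⧸ Γ) := chart_mem_atlas _ _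
  have := hat (e (F y)) (e.map_source hy)
  rwa [e.left_inv hy] at this

theorem eventually_along_proj_comp {φ : V → E 3} {x : V} (hφ : ContDiffAt ℝ 2 φ x)
    (θ : DForm 3 1 (Gk k ⧸ Γ)) (v : V) :
    along (proj Γ ∘ φ) θ v =ᶠ[𝓝 x]
      fun y => toFunctional 3 (pullback (m := 3) (proj Γ) θ (φ y)) (fderiv ℝ φ y v) := by
  filter_upwards [hφ.eventually (by simp)] with y hy
  rw [← along_pullback (m := 3) ((contMDiff_proj Γ).mdifferentiable (by simp) _)
    (hy.differentiableAt (by simp)).mdifferentiableAt]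
  exact along_modelSpace φ _ v y

/-- A lift to `G_k` computes the values of the forms on `G_k / Γ` and their exterior
derivatives. -/
theorem hasExtD_of_lift {θ : DForm 3 1 (Gk k ⧸ Γ)} {ζ : DForm 3 2 (Gk k ⧸ Γ)}
    {T : E 3 → E 3 →L[ℝ] ℝ} (hT : Differentiable ℝ T)
    (hθ : ∀ y, toFunctional 3 (pullback (m := 3) (proj Γ) θ y) = T y)
    (hζ : ∀ y v w : E 3, pullback (m := 3) (proj Γ) ζ y ![v, w] =
      fderiv ℝ T y v w - fderiv ℝ T y w v) : HasExtD θ ζ := by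
  intro V _ _ F x hF
  obtain ⟨φ, hφ, hFφ⟩ := exists_local_lift hF
  have hev : ∀ v, along F θ v =ᶠ[𝓝 x] fun y => T (φ y) (fderiv ℝ φ y v) := fun v => by
    filter_upwards [along_congr (m := 3) hFφ θ v, eventually_along_proj_comp hφ θ v] with y h1 h2
    rw [h1, h2, hθ]
  refine ⟨fun v => ?_, fun v w => ?_⟩
  · obtain ⟨D, hD, -⟩ := hasFDerivAt_oneForm_comp hφ (hT _) v
    exact hD.differentiableAt.congr_of_eventuallyEq (hev v)
  · rw [(hev v).fderiv_eq, (hev w).fderiv_eq, fderiv_oneForm_comp_sub hφ (hT _), ← hζ]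
    have hd := fun v => dAlong_comp (m := 3) (m' := 3) (f := proj Γ) (F := φ) (x := x)
      ((contMDiff_proj Γ).mdifferentiable (by simp) _)
      (hφ.differentiableAt (by simp)).mdifferentiableAt v
    have e1 : ∀ v, dAlong (m := 3) F x v = (mfderiv (𝓡 3) (𝓡 3) (proj Γ) (φ x) : E 3 →L[ℝ] E 3)
        (fderiv ℝ φ x v) := fun v => by
      have h1 : dAlong (m := 3) F x = dAlong (m := 3) (proj Γ ∘ φ) x :=
        hFφ.mfderiv_eq
      rw [h1]
      refine (hd v).trans ?_
      simp only [dAlong, mfderiv_eq_fderiv]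
      rfl
    rw [e1, e1]
    have h0 : F x = proj Γ (φ x) := hFφ.self_of_nhds
    refine Eq.trans ?_ (congrArg (fun q : Gk k ⧸ Γ => (ζ q : E 3 [⋀^Fin 2]→L[ℝ] ℝ) _) h0).symm
    change ζ (proj Γ (φ x)) (mfderiv (𝓡 3) (𝓡 3) (proj Γ) (φ x) ∘ _) = _
    congr 1
    ext i
    fin_cases i <;> rfl

end Quotient

section Quotient

variable {k : ℝ} (Γ : Subgroup (Gk k)) [DiscreteTopology Γ]

theorem pullback_wedge {m m' : ℕ} {M : Type*} [TopologicalSpace M] [ChartedSpace (E m) M]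
    {M' : Type*} [TopologicalSpace M'] [ChartedSpace (E m') M'] (f : M → M')
    (a b : DForm m' 1 M') :
    pullback (m := m) f (wedge a b) = wedge (pullback (m := m) f a) (pullback (m := m) f b) :=
  rfl

theorem pullback_smul {m m' r : ℕ} {M : Type*} [TopologicalSpace M] [ChartedSpace (E m) M]
    {M' : Type*} [TopologicalSpace M'] [ChartedSpace (E m') M'] (f : M → M') (c : ℝ)
    (a : DForm m' r M') : pullback (m := m) f (c • a) = c • pullback (m := m) f a :=
  rfl

theorem hasFDerivAt_affineForm (L₁ L₂ : E 3 →L[ℝ] ℝ) (c : ℝ) (i : Fin 3) (y : E 3) :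
    HasFDerivAt (fun y : E 3 => L₁ + (c * y i) • L₂)
      ((c • (EuclideanSpace.proj i : E 3 →L[ℝ] ℝ)).smulRight L₂) y := by
  have h : HasFDerivAt (fun y : E 3 => c * y i) (c • (EuclideanSpace.proj i : E 3 →L[ℝ] ℝ)) y :=
    (EuclideanSpace.proj i : E 3 →L[ℝ] ℝ).hasFDerivAt.const_mul c
  exact (h.smul_const L₂).const_add L₁

theorem hasExtD_alpha : HasExtD (alpha Γ) ((-k) • wedge (alpha Γ) (gamma Γ)) := by
  have hd := hasFDerivAt_affineForm (EuclideanSpace.proj 0) (EuclideanSpace.proj 2) (-k) 0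
  refine hasExtD_of_lift (T := fun y => EuclideanSpace.proj 0 + (-k * y 0) • EuclideanSpace.proj 2)
    (fun y => (hd y).differentiableAt) (fun y => ?_) fun y v w => ?_
  · rw [pullback_alpha]
    ext v
    change v 0 - k * y 0 * v 2 = v 0 + -k * y 0 * v 2
    ring
  · rw [pullback_smul, pullback_wedge, pullback_alpha, pullback_gamma, (hd y).fderiv]
    change -k * ((v 0 - k * y 0 * v 2) * w 2 - (w 0 - k * y 0 * w 2) * v 2) =
      -k * v 0 * w 2 - -k * w 0 * v 2
    ring

theorem hasExtD_beta : HasExtD (beta Γ) (k • wedge (beta Γ) (gamma Γ)) := by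
  have hd := hasFDerivAt_affineForm (EuclideanSpace.proj 1) (EuclideanSpace.proj 2) k 1
  refine hasExtD_of_lift (T := fun y => EuclideanSpace.proj 1 + (k * y 1) • EuclideanSpace.proj 2)
    (fun y => (hd y).differentiableAt) (fun y => ?_) fun y v w => ?_
  · rw [pullback_beta]
    rfl
  · rw [pullback_smul, pullback_wedge, pullback_beta, pullback_gamma, (hd y).fderiv]
    change k * ((v 1 + k * y 1 * v 2) * w 2 - (w 1 + k * y 1 * w 2) * v 2) =
      k * v 1 * w 2 - k * w 1 * v 2
    ring

theorem hasExtD_gamma : HasExtD (gamma Γ) 0 := by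
  refine hasExtD_of_lift (T := fun _ => EuclideanSpace.proj 2)
    (fun y => differentiableAt_const _) (fun y => ?_) fun y v w => ?_
  · rw [pullback_gamma]
    rfl
  · rw [fderiv_const_apply]
    change (0 : ℝ) = 0 - 0
    ring

end Quotient

/-! ### Exterior derivatives of wedge products -/

section TwoForms

variable {V : Type} [NormedAddCommGroup V] [NormedSpace ℝ V]
  {m : ℕ} {M : Type*} [TopologicalSpace M] [ChartedSpace (E m) M]

/-- The value at `(v, w)` of the pull-back of a `2`-form by a map from a normed space. -/
noncomputable def along₂ (F : V → M) (Ω : DForm m 2 M) (v w y : V) : ℝ :=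
  Ω (F y) ![dAlong F y v, dAlong F y w]

theorem along₂_wedge (F : V → M) (a b : DForm m 1 M) (v w y : V) :
    along₂ F (wedge a b) v w y =
      along F a v y * along F b w y - along F a w y * along F b v y := rfl

theorem HasExtD.fderiv_sub {θ : DForm m 1 M} {ζ : DForm m 2 M} (h : HasExtD θ ζ) {F : V → M}
    {x : V} (hF : ContMDiffAt 𝓘(ℝ, V) (𝓡 m) 2 F x) (v w : V) :
    fderiv ℝ (along F θ w) x v - fderiv ℝ (along F θ v) x w = along₂ F ζ v w x :=
  (h V F x hF).2 v w

theorem HasExtD.differentiableAt {θ : DForm m 1 M} {ζ : DForm m 2 M} (h : HasExtD θ ζ) {F : V → M}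
    {x : V} (hF : ContMDiffAt 𝓘(ℝ, V) (𝓡 m) 2 F x) (v : V) :
    DifferentiableAt ℝ (along F θ v) x :=
  (h V F x hF).1 v

/-- The sum of the derivatives `u(f(v, w)) + v(f(w, u)) + w(f(u, v))` at `x`. -/
noncomputable def cyclicDeriv (f : V → V → V → ℝ) (u v w x : V) : ℝ :=
  fderiv ℝ (f v w) x u + fderiv ℝ (f w u) x v + fderiv ℝ (f u v) x w

/-- The sum `c(u) f(v, w) + c(v) f(w, u) + c(w) f(u, v)` at `x`. -/
noncomputable def cyclicProd (c : V → V → ℝ) (f : V → V → V → ℝ) (u v w x : V) : ℝ :=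
  c u x * f v w x + c v x * f w u x + c w x * f u v x

theorem HasExtD.hasFDerivAt_wedge {a b : DForm m 1 M} {a' b' : DForm m 2 M} (ha : HasExtD a a')
    (hb : HasExtD b b') {F : V → M} {x : V} (hF : ContMDiffAt 𝓘(ℝ, V) (𝓡 m) 2 F x) (v w : V) :
    HasFDerivAt (along₂ F (wedge a b) v w)
      (along F a v x • fderiv ℝ (along F b w) x + along F b w x • fderiv ℝ (along F a v) x -
        (along F a w x • fderiv ℝ (along F b v) x + along F b v x • fderiv ℝ (along F a w) x)) x :=
  ((ha.differentiableAt hF v).hasFDerivAt.mul (hb.differentiableAt hF w).hasFDerivAt).sub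
    ((ha.differentiableAt hF w).hasFDerivAt.mul (hb.differentiableAt hF v).hasFDerivAt)

/-- `d(a ∧ b) = da ∧ b - a ∧ db`. -/
theorem HasExtD.cyclicDeriv_wedge {a b : DForm m 1 M} {a' b' : DForm m 2 M} (ha : HasExtD a a')
    (hb : HasExtD b b') {F : V → M} {x : V} (hF : ContMDiffAt 𝓘(ℝ, V) (𝓡 m) 2 F x) (u v w : V) :
    cyclicDeriv (along₂ F (wedge a b)) u v w x =
      cyclicProd (along F b) (along₂ F a') u v w x -
        cyclicProd (along F a) (along₂ F b') u v w x := by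
  simp only [cyclicDeriv, cyclicProd, (ha.hasFDerivAt_wedge hb hF _ _).fderiv,
    ← ha.fderiv_sub hF, ← hb.fderiv_sub hF]
  simp
  ring

end TwoForms

/-! ### The Lee form and its uniqueness -/

section Lcs

variable {M : Type*} [TopologicalSpace M] [ChartedSpace (E 4) M]

/-- The form `t₁ a∧e + t₂ b∧c + t₃ (r a∧b - k c∧e)`. -/
noncomputable def lcsForm (k r : ℝ) (a b c e : DForm 4 1 M) (t₁ t₂ t₃ : ℝ) : DForm 4 2 M :=
  t₁ • wedge a e + t₂ • wedge b c + t₃ • (r • wedge a b - k • wedge c e)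

/-- A coframe `a, b, c, e` with `da = -k a∧c`, `db = k b∧c`, `dc = 0` and `de = r a∧b`. -/
structure IsLcsCoframe (k r : ℝ) (a b c e : DForm 4 1 M) : Prop where
  da : HasExtD a ((-k) • wedge a c)
  db : HasExtD b (k • wedge b c)
  dc : HasExtD c 0
  de : HasExtD e (r • wedge a b)
  exists_dual : ∀ p : M, ∃ A B C T : TangentSpace (𝓡 4) p,
    (a p (fun _ => A) = 1 ∧ b p (fun _ => A) = 0 ∧ c p (fun _ => A) = 0 ∧ e p (fun _ => A) = 0) ∧
    (a p (fun _ => B) = 0 ∧ b p (fun _ => B) = 1 ∧ c p (fun _ => B) = 0 ∧ e p (fun _ => B) = 0) ∧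
    (a p (fun _ => C) = 0 ∧ b p (fun _ => C) = 0 ∧ c p (fun _ => C) = 1 ∧ e p (fun _ => C) = 0) ∧
    (a p (fun _ => T) = 0 ∧ b p (fun _ => T) = 0 ∧ c p (fun _ => T) = 0 ∧ e p (fun _ => T) = 1)

variable {k r : ℝ} {a b c e : DForm 4 1 M}
  {V : Type} [NormedAddCommGroup V] [NormedSpace ℝ V]

theorem along₂_lcsForm (F : V → M) (k r : ℝ) (a b c e : DForm 4 1 M) (t₁ t₂ t₃ : ℝ) (v w y : V) :
    along₂ F (lcsForm k r a b c e t₁ t₂ t₃) v w y =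
      t₁ * along₂ F (wedge a e) v w y + t₂ * along₂ F (wedge b c) v w y +
        t₃ * (r * along₂ F (wedge a b) v w y - k * along₂ F (wedge c e) v w y) := rfl

theorem IsLcsCoframe.hasFDerivAt (h : IsLcsCoframe k r a b c e) {F : V → M} {x : V} (hF : ContMDiffAt 𝓘(ℝ, V) (𝓡 4) 2 F x)
    (t₁ t₂ t₃ : ℝ) (v w : V) :
    HasFDerivAt (along₂ F (lcsForm k r a b c e t₁ t₂ t₃) v w)
      (t₁ • fderiv ℝ (along₂ F (wedge a e) v w) x + t₂ • fderiv ℝ (along₂ F (wedge b c) v w) x +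
        t₃ • (r • fderiv ℝ (along₂ F (wedge a b) v w) x -
          k • fderiv ℝ (along₂ F (wedge c e) v w) x)) x := by
  have h1 := (h.da.hasFDerivAt_wedge h.de hF v w).differentiableAt.hasFDerivAt
  have h2 := (h.db.hasFDerivAt_wedge h.dc hF v w).differentiableAt.hasFDerivAt
  have h3 := (h.da.hasFDerivAt_wedge h.db hF v w).differentiableAt.hasFDerivAt
  have h4 := (h.dc.hasFDerivAt_wedge h.de hF v w).differentiableAt.hasFDerivAt
  exact ((h1.const_mul t₁).add (h2.const_mul t₂)).add
    (((h3.const_mul r).sub (h4.const_mul k)).const_mul t₃)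

/-- The form `Ω` is locally conformal symplectic with Lee form `k c`: `dΩ = k c ∧ Ω`. -/
theorem IsLcsCoframe.cyclicDeriv_eq (h : IsLcsCoframe k r a b c e) {F : V → M} {x : V}
    (hF : ContMDiffAt 𝓘(ℝ, V) (𝓡 4) 2 F x) (t₁ t₂ t₃ : ℝ) (u v w : V) :
    cyclicDeriv (along₂ F (lcsForm k r a b c e t₁ t₂ t₃)) u v w x =
      k * cyclicProd (along F c) (along₂ F (lcsForm k r a b c e t₁ t₂ t₃)) u v w x := by
  have h1 := h.da.cyclicDeriv_wedge h.de hF u v w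
  have h2 := h.db.cyclicDeriv_wedge h.dc hF u v w
  have h3 := h.da.cyclicDeriv_wedge h.db hF u v w
  have h4 := h.dc.cyclicDeriv_wedge h.de hF u v w
  have e1 : ∀ (s : ℝ) (ζ : DForm 4 2 M) (v w : V), along₂ F (s • ζ) v w x = s * along₂ F ζ v w x :=
    fun _ _ _ _ => rfl
  have e2 : ∀ v w : V, along₂ F (0 : DForm 4 2 M) v w x = 0 := fun _ _ => rfl
  have h5 : cyclicDeriv (along₂ F (lcsForm k r a b c e t₁ t₂ t₃)) u v w x =
      t₁ * cyclicDeriv (along₂ F (wedge a e)) u v w x +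
      t₂ * cyclicDeriv (along₂ F (wedge b c)) u v w x +
      t₃ * (r * cyclicDeriv (along₂ F (wedge a b)) u v w x -
        k * cyclicDeriv (along₂ F (wedge c e)) u v w x) := by
    simp only [cyclicDeriv, (h.hasFDerivAt hF t₁ t₂ t₃ _ _).fderiv]
    simp
    ring
  rw [h5, h1, h2, h3, h4]
  simp only [cyclicProd, e1, e2, along₂_lcsForm, along₂_wedge]
  ring

/-- The Lee form is determined by a nondegenerate form. -/
theorem lcs_covector_eq_zero {X : Type*} (δ : X → ℝ) (f : X → X → ℝ)
    (hf : ∀ u v w, δ u * f v w + δ v * f w u + δ w * f u v = 0) (hskew : ∀ v w, f w v = -f v w)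
    {t₁ t₂ t₃ k r : ℝ} (ht : t₁ * t₂ ≠ 0) (ht' : t₁ * t₂ ≠ r * k * t₃ ^ 2) {A B C T : X}
    (h1 : f A T = t₁) (h2 : f B C = t₂) (h3 : f A B = t₃ * r) (h4 : f C T = -(k * t₃))
    (h5 : f A C = 0) (h6 : f B T = 0) (u : X) : δ u = 0 := by
  -- This number is the Pfaffian of `f` in the basis `A, B, C, T`. It is enough to show `δ A = δ T =
  -- 0`, because the relation for `u, A, T` then reads `δ u * t₁ = 0`.
  have hdet : t₁ * t₂ - r * k * t₃ ^ 2 ≠ 0 := sub_ne_zero.2 ht'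
  have t10 : t₁ ≠ 0 := left_ne_zero_of_mul ht
  have q1 := hf A B C
  have q2 := hf A B T
  have q3 := hf A C T
  have q4 := hf B C T
  rw [hskew A C, h2, h5, h3] at q1
  rw [hskew A T, h6, h1, h3] at q2
  rw [hskew A T, h4, h1, h5] at q3
  rw [hskew B T, h4, h6, h2] at q4
  have hA : δ A = 0 := by
    refine (mul_eq_zero.1 (?_ : (t₁ * t₂ - r * k * t₃ ^ 2) * δ A = 0)).resolve_left hdet
    linear_combination t₁ * q1 + r * t₃ * q3
  have hT : δ T = 0 := by
    refine (mul_eq_zero.1 (?_ : (t₁ * t₂ - r * k * t₃ ^ 2) * δ T = 0)).resolve_left hdet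
    linear_combination t₁ * q4 - k * t₃ * q2
  have q5 := hf u A T
  rw [hA, hT, h1] at q5
  simpa [t10] using q5

end Lcs

section Invariance

variable {M : Type*} [TopologicalSpace M] [ChartedSpace (E 4) M]
  {V : Type} [NormedAddCommGroup V] [NormedSpace ℝ V]

theorem along₂_comp {f : M → M} (hf : MDifferentiable (𝓡 4) (𝓡 4) f) {F : V → M} {x : V}
    (hF : MDifferentiableAt 𝓘(ℝ, V) (𝓡 4) F x) (Ω : DForm 4 2 M) (v w : V) :
    along₂ (f ∘ F) Ω v w x = along₂ F (pullback (m := 4) f Ω) v w x := by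
  have hd := fun v => dAlong_comp (hf (F x)) hF v
  simp only [along₂]
  rw [hd, hd]
  change _ = Ω (f (F x)) (mfderiv (𝓡 4) (𝓡 4) f (F x) ∘ _)
  congr 1
  ext i
  fin_cases i <;> rfl

theorem contMDiffAt_chart_symm [IsManifold (𝓡 4) ∞ M] (p : M) {x : E 4} (hx : x ∈ (chartAt (E 4) p).target) :
    ContMDiffAt (𝓡 4) (𝓡 4) 2 (chartAt (E 4) p).symm x :=
  ((contMDiffOn_symm_of_mem_maximalAtlas (I := 𝓡 4) (n := ∞)
    (IsManifold.chart_mem_maximalAtlas p)).contMDiffAt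
      ((chartAt (E 4) p).open_target.mem_nhds hx)).of_le two_le_infty

/-- A map that preserves a nondegenerate form `Ω` with `dΩ = k c ∧ Ω` and `k ≠ 0` preserves the
form `c`. -/
theorem IsLcsCoframe.pullback_lee [IsManifold (𝓡 4) ∞ M] {k r : ℝ} {a b c e : DForm 4 1 M}
    (h : IsLcsCoframe k r a b c e) (hk : k ≠ 0) {t₁ t₂ t₃ : ℝ} (ht : t₁ * t₂ ≠ 0)
    (ht' : t₁ * t₂ ≠ r * k * t₃ ^ 2) {f : M → M} (hf : ContMDiff (𝓡 4) (𝓡 4) 2 f)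
    (hΩ : pullback (m := 4) f (lcsForm k r a b c e t₁ t₂ t₃) = lcsForm k r a b c e t₁ t₂ t₃) :
    pullback (m := 4) f c = c := by
  set Ω := lcsForm k r a b c e t₁ t₂ t₃ with hΩdef
  have hfd : MDifferentiable (𝓡 4) (𝓡 4) f := hf.mdifferentiable (by simp)
  have key : ∀ p : M, ∀ x ∈ (chartAt (E 4) p).target,
      pullback (m := 4) f c ((chartAt (E 4) p).symm x) = c ((chartAt (E 4) p).symm x) := by
    intro p x hx
    set F : E 4 → M := ⇑(chartAt (E 4) p).symm
    have hF : ContMDiffAt 𝓘(ℝ, E 4) (𝓡 4) 2 F x := contMDiffAt_chart_symm p hx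
    have hfF : ContMDiffAt 𝓘(ℝ, E 4) (𝓡 4) 2 (f ∘ F) x := (hf _).comp x hF
    have hsurj : Function.Surjective (dAlong (m := 4) F x) :=
      (mdifferentiable_of_mem_atlas (I := 𝓡 4)
        (chart_mem_atlas (E 4) p)).symm.mfderiv_surjective hx
    have hev : ∀ v w, along₂ (f ∘ F) Ω v w =ᶠ[𝓝 x] along₂ F Ω v w := fun v w => by
      filter_upwards [eventually_mdifferentiableAt hF] with y hy
      rw [along₂_comp hfd hy, hΩ]
    -- Near `x` the pull-backs of `Ω` by `F` and by `f ∘ F` agree, hence so do their exterior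
    -- derivatives. Comparing the two Lee equations and cancelling `k` gives `(f^*c - c) ∧ Ω = 0`.
    have hδ : ∀ u v w, (along (f ∘ F) c u x - along F c u x) * along₂ F Ω v w x +
        (along (f ∘ F) c v x - along F c v x) * along₂ F Ω w u x +
        (along (f ∘ F) c w x - along F c w x) * along₂ F Ω u v x = 0 := by
      intro u v w
      have h1 := h.cyclicDeriv_eq hF t₁ t₂ t₃ u v w
      have h2 := h.cyclicDeriv_eq hfF t₁ t₂ t₃ u v w
      rw [← hΩdef] at h1 h2
      simp only [cyclicDeriv, cyclicProd, (hev _ _).fderiv_eq, (hev _ _).self_of_nhds] at h1 h2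
      rw [h1] at h2
      linear_combination -(mul_left_cancel₀ hk h2)
    have hval : ∀ v w, along₂ F Ω v w x =
        t₁ * (a (F x) (fun _ => dAlong F x v) * e (F x) (fun _ => dAlong F x w) -
          a (F x) (fun _ => dAlong F x w) * e (F x) (fun _ => dAlong F x v)) +
        t₂ * (b (F x) (fun _ => dAlong F x v) * c (F x) (fun _ => dAlong F x w) -
          b (F x) (fun _ => dAlong F x w) * c (F x) (fun _ => dAlong F x v)) +
        t₃ * (r * (a (F x) (fun _ => dAlong F x v) * b (F x) (fun _ => dAlong F x w) -
          a (F x) (fun _ => dAlong F x w) * b (F x) (fun _ => dAlong F x v)) -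
          k * (c (F x) (fun _ => dAlong F x v) * e (F x) (fun _ => dAlong F x w) -
          c (F x) (fun _ => dAlong F x w) * e (F x) (fun _ => dAlong F x v))) := fun _ _ => rfl
    have hskew : ∀ v w, along₂ F Ω w v x = -along₂ F Ω v w x := fun v w => by
      rw [hval, hval]
      ring
    obtain ⟨A, B, C, T, hA, hB, hC, hT⟩ := h.exists_dual (F x)
    obtain ⟨A, rfl⟩ := hsurj A
    obtain ⟨B, rfl⟩ := hsurj B
    obtain ⟨C, rfl⟩ := hsurj C
    obtain ⟨T, rfl⟩ := hsurj T
    obtain ⟨hA1, hA2, hA3, hA4⟩ := hA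
    obtain ⟨hB1, hB2, hB3, hB4⟩ := hB
    obtain ⟨hC1, hC2, hC3, hC4⟩ := hC
    obtain ⟨hT1, hT2, hT3, hT4⟩ := hT
    have hzero := lcs_covector_eq_zero (k := k) (r := r) (t₃ := t₃)
      (fun u => along (f ∘ F) c u x - along F c u x)
      (fun v w => along₂ F Ω v w x) hδ hskew ht ht' (A := A) (B := B) (C := C) (T := T)
      (by simp only [hval, hA1, hA2, hA3, hA4, hT1, hT2, hT3, hT4]; ring)
      (by simp only [hval, hB1, hB2, hB3, hB4, hC1, hC2, hC3, hC4]; ring)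
      (by simp only [hval, hA1, hA2, hA3, hA4, hB1, hB2, hB3, hB4]; ring)
      (by simp only [hval, hC1, hC2, hC3, hC4, hT1, hT2, hT3, hT4]; ring)
      (by simp only [hval, hA1, hA2, hA3, hA4, hC1, hC2, hC3, hC4]; ring)
      (by simp only [hval, hB1, hB2, hB3, hB4, hT1, hT2, hT3, hT4]; ring)
    ext v
    obtain ⟨u, hu⟩ := hsurj (v 0)
    have hv : v = fun _ => dAlong (m := 4) F x u := by
      ext i
      rw [hu, Subsingleton.elim i 0]
    have h3 := sub_eq_zero.1 (hzero u)
    rw [← along_pullback (hfd _) (hF.mdifferentiableAt (by simp))] at h3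
    rw [hv]
    exact h3
  funext p
  have h4 := key p _ (mem_chart_target (E 4) p)
  rwa [(chartAt (E 4) p).left_inv (mem_chart_source (E 4) p)] at h4

end Invariance

/-! ### Vector fields generated by curves in the group -/

section Slices

variable {m : ℕ} {M : Type*} [TopologicalSpace M] [ChartedSpace (E m) M]
  {V : Type*} [NormedAddCommGroup V] [NormedSpace ℝ V]
  {W : Type*} [NormedAddCommGroup W] [NormedSpace ℝ W]

theorem dAlong_comp_right {Φ : W → M} {i : V → W} {i' : V →L[ℝ] W} {y : V}
    (hΦ : MDifferentiableAt 𝓘(ℝ, W) (𝓡 m) Φ (i y)) (hi : HasFDerivAt i i' y) (v : V) :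
    dAlong (m := m) (Φ ∘ i) y v = dAlong (m := m) Φ (i y) (i' v) := by
  simp only [dAlong]
  rw [mfderiv_comp y hΦ hi.hasMFDerivAt.mdifferentiableAt, hi.hasMFDerivAt.mfderiv]
  rfl

theorem dAlong_snd {Φ : W × V → M} {u : W} {y : V}
    (hΦ : MDifferentiableAt 𝓘(ℝ, W × V) (𝓡 m) Φ (u, y)) (v : V) :
    dAlong (m := m) (fun y => Φ (u, y)) y v = dAlong (m := m) Φ (u, y) (0, v) :=
  dAlong_comp_right hΦ (hasFDerivAt_prodMk_right u y) v

theorem dAlong_fst {Φ : W × V → M} {u : W} {y : V}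
    (hΦ : MDifferentiableAt 𝓘(ℝ, W × V) (𝓡 m) Φ (u, y)) (v : W) :
    dAlong (m := m) (fun u => Φ (u, y)) u v = dAlong (m := m) Φ (u, y) (v, 0) :=
  dAlong_comp_right (i := fun u => (u, y)) hΦ (hasFDerivAt_prodMk_left u y) v

end Slices

section Curves

theorem contMDiff_smul_two {M : Type*} [TopologicalSpace M] [ChartedSpace (E 4) M] (d : ℕ)
    {G : Type*} [Group G] [TopologicalSpace G] [ChartedSpace (E d) G] [MulAction G M]
    [ContMDiffSMul (𝓡 d) (𝓡 4) ∞ G M] (c : G) :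
    ContMDiff (𝓡 4) (𝓡 4) 2 (fun p : M => c • p) :=
  (ContMDiffSMul.contMDiff_const_smul (I := 𝓡 d) (n := ∞) c).of_le two_le_infty

variable {M : Type*} [TopologicalSpace M] [ChartedSpace (E 4) M]
  {d : ℕ} {G : Type*} [Group G] [TopologicalSpace G] [ChartedSpace (E d) G]
  [MulAction G M] [ContMDiffSMul (𝓡 d) (𝓡 4) ∞ G M]
  {V : Type} [NormedAddCommGroup V] [NormedSpace ℝ V]

/-- The value of a `1`-form `θ` on the vector field on `M` generated by the curve `g` in `G`. -/
noncomputable def flowVal (g : ℝ → G) (θ : DForm 4 1 M) (p : M) : ℝ :=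
  along (fun u : ℝ => g u • p) θ 1 0

/-- The map `(u, y) ↦ g(u) • F(y)`. -/
def sweep (g : ℝ → G) (F : V → M) (q : ℝ × V) : M := g q.1 • F q.2

variable {g : ℝ → G} {F : V → M} {x : V}

theorem contMDiffAt_sweep (hg : ContMDiffAt 𝓘(ℝ, ℝ) (𝓡 d) 2 g 0)
    (hF : ContMDiffAt 𝓘(ℝ, V) (𝓡 4) 2 F x) :
    ContMDiffAt 𝓘(ℝ, ℝ × V) (𝓡 4) 2 (sweep g F) (0, x) := by
  have : ContMDiffSMul (𝓡 d) (𝓡 4) 2 G M := ContMDiffSMul.of_le two_le_infty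
  have h1 : ContMDiffAt 𝓘(ℝ, ℝ × V) 𝓘(ℝ, ℝ) 2 Prod.fst ((0 : ℝ), x) :=
    contDiff_fst.contMDiff.contMDiffAt
  have h2 : ContMDiffAt 𝓘(ℝ, ℝ × V) 𝓘(ℝ, V) 2 Prod.snd ((0 : ℝ), x) :=
    contDiff_snd.contMDiff.contMDiffAt
  exact ContMDiffAt.smul (ContMDiffAt.comp ((0 : ℝ), x) hg h1)
    (ContMDiffAt.comp ((0 : ℝ), x) hF h2)

/-- The velocity of `u ↦ g(u) • F(x)` at `u = 0` is the `u`-derivative of `sweep g F`. The function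
`θ(X)` is therefore a component of the pull-back of `θ` by a map of class `C²`, and exterior
derivatives can be computed on `ℝ × V`. -/
theorem flowVal_comp (hg : ContMDiffAt 𝓘(ℝ, ℝ) (𝓡 d) 2 g 0)
    (hF : ContMDiffAt 𝓘(ℝ, V) (𝓡 4) 2 F x) (θ : DForm 4 1 M) :
    flowVal g θ (F x) = along (sweep g F) θ (1, 0) (0, x) := by
  have h := dAlong_fst (m := 4) ((contMDiffAt_sweep hg hF).mdifferentiableAt (by simp)) 1
  simp only [along]
  rw [← h]
  rfl

theorem eventually_flowVal_comp [IsManifold (𝓡 4) ∞ M] (hg : ContMDiffAt 𝓘(ℝ, ℝ) (𝓡 d) 2 g 0)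
    (hF : ContMDiffAt 𝓘(ℝ, V) (𝓡 4) 2 F x) (θ : DForm 4 1 M) :
    (fun y => flowVal g θ (F y)) =ᶠ[𝓝 x] fun y => along (sweep g F) θ (1, 0) (0, y) := by
  have : IsManifold (𝓡 4) 2 M := IsManifold.of_le (n := ∞) two_le_infty
  filter_upwards [(contMDiffAt_iff_contMDiffAt_nhds (by simp)).1 hF] with y hy
  exact flowVal_comp hg hy θ

theorem HasExtD.hasFDerivAt_flowVal [IsManifold (𝓡 4) ∞ M] {θ : DForm 4 1 M} {ζ : DForm 4 2 M} (h : HasExtD θ ζ)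
    (hg : ContMDiffAt 𝓘(ℝ, ℝ) (𝓡 d) 2 g 0) (hF : ContMDiffAt 𝓘(ℝ, V) (𝓡 4) 2 F x) :
    HasFDerivAt (fun y => flowVal g θ (F y))
      ((fderiv ℝ (along (sweep g F) θ (1, 0)) (0, x)).comp (.inr ℝ ℝ V)) x := by
  refine HasFDerivAt.congr_of_eventuallyEq ?_ (eventually_flowVal_comp hg hF θ)
  exact (h.differentiableAt (contMDiffAt_sweep hg hF) (1, 0)).hasFDerivAt.comp x
    (hasFDerivAt_prodMk_right 0 x)

theorem HasExtD.continuous_flowVal [IsManifold (𝓡 4) ∞ M] {θ : DForm 4 1 M} {ζ : DForm 4 2 M} (h : HasExtD θ ζ)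
    (hg : ContMDiffAt 𝓘(ℝ, ℝ) (𝓡 d) 2 g 0) : Continuous (flowVal g θ : M → ℝ) := by
  refine continuous_iff_continuousAt.2 fun p => ?_
  set ch := chartAt (E 4) p
  have hd := (h.hasFDerivAt_flowVal hg
    (contMDiffAt_chart_symm p (mem_chart_target (E 4) p))).continuousAt
  have hc : ContinuousAt ch p := ch.continuousAt (mem_chart_source (E 4) p)
  refine (ContinuousAt.comp (f := ch) hd hc).congr ?_
  filter_upwards [ch.open_source.mem_nhds (mem_chart_source (E 4) p)] with q hq
  exact congrArg (flowVal g θ) (ch.left_inv hq)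

/-- Each slice of the sweep at a fixed `u` is `g(u) ∘ F`, so an invariant form has the same
pull-back to all slices. Differentiating in `u` expresses that the Lie derivative along `X`
vanishes. -/
theorem eventually_along_sweep [IsManifold (𝓡 4) ∞ M] {θ : DForm 4 1 M} (hθ : ∀ c : G, pullback (m := 4)
      (fun p : M => c • p) θ = θ) (hg : ContMDiffAt 𝓘(ℝ, ℝ) (𝓡 d) 2 g 0)
    (hF : ContMDiffAt 𝓘(ℝ, V) (𝓡 4) 2 F x) (v : V) :
    along (sweep g F) θ (0, v) =ᶠ[𝓝 (0, x)] fun q => along F θ v q.2 := by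
  filter_upwards [eventually_mdifferentiableAt (contMDiffAt_sweep hg hF),
    continuousAt_snd.eventually (eventually_mdifferentiableAt hF)] with q h1 h2
  have h3 := dAlong_snd (m := 4) (u := q.1) (y := q.2) h1 v
  have h4 := along_pullback (m := 4) (m' := 4) (f := fun p : M => g q.1 • p) (F := F) (x := q.2)
    ((contMDiff_smul_two d (g q.1)).mdifferentiable (by simp) _) h2 θ v
  rw [hθ] at h4
  rw [h4]
  simp only [along]
  rw [← h3]
  rfl

theorem eventually_along₂_sweep [IsManifold (𝓡 4) ∞ M] {Ω : DForm 4 2 M} (hΩ : ∀ c : G, pullback (m := 4)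
      (fun p : M => c • p) Ω = Ω) (hg : ContMDiffAt 𝓘(ℝ, ℝ) (𝓡 d) 2 g 0)
    (hF : ContMDiffAt 𝓘(ℝ, V) (𝓡 4) 2 F x) (v w : V) :
    along₂ (sweep g F) Ω (0, v) (0, w) =ᶠ[𝓝 (0, x)] fun q => along₂ F Ω v w q.2 := by
  filter_upwards [eventually_mdifferentiableAt (contMDiffAt_sweep hg hF),
    continuousAt_snd.eventually (eventually_mdifferentiableAt hF)] with q h1 h2
  have h3 := dAlong_snd (m := 4) (u := q.1) (y := q.2) h1
  have h4 := along₂_comp (f := fun p : M => g q.1 • p) (F := F) (x := q.2)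
    ((contMDiff_smul_two d (g q.1)).mdifferentiable (by simp)) h2 Ω v w
  rw [hΩ] at h4
  rw [← h4]
  simp only [along₂]
  rw [← h3, ← h3]
  rfl

theorem fderiv_inl_eq_zero {f : ℝ × V → ℝ} {f₂ : V → ℝ} {x : V}
    (h : f =ᶠ[𝓝 (0, x)] fun q => f₂ q.2) (hf : DifferentiableAt ℝ f (0, x)) :
    fderiv ℝ f (0, x) (1, 0) = 0 := by
  have h1 : HasFDerivAt (fun u : ℝ => f (u, x)) _ 0 :=
    hf.hasFDerivAt.comp (0 : ℝ) (hasFDerivAt_prodMk_left 0 x)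
  have h2 : (fun u : ℝ => f (u, x)) =ᶠ[𝓝 0] fun _ => f₂ x :=
    (Continuous.prodMk_left x).continuousAt.eventually h
  have h3 := h1.unique ((hasFDerivAt_const (f₂ x) (0 : ℝ)).congr_of_eventuallyEq h2)
  simpa using DFunLike.congr_fun h3 (1 : ℝ)

/-- A closed invariant `1`-form is locally constant on the vector fields of the action. -/
theorem HasExtD.hasFDerivAt_flowVal_zero [IsManifold (𝓡 4) ∞ M] {θ : DForm 4 1 M} (h : HasExtD θ 0)
    (hθ : ∀ c : G, pullback (m := 4) (fun p : M => c • p) θ = θ)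
    (hg : ContMDiffAt 𝓘(ℝ, ℝ) (𝓡 d) 2 g 0) (hF : ContMDiffAt 𝓘(ℝ, V) (𝓡 4) 2 F x) :
    HasFDerivAt (fun y => flowVal g θ (F y)) (0 : V →L[ℝ] ℝ) x := by
  convert h.hasFDerivAt_flowVal hg hF using 1
  symm
  ext v
  -- This is Cartan's formula: `dθ(X, v) = X(θ(v)) - v(θ(X))`, where the left side vanishes by
  -- closedness and the first term on the right by invariance.
  have h1 := h.fderiv_sub (contMDiffAt_sweep hg hF) (1, 0) (0, v)
  rw [fderiv_inl_eq_zero (eventually_along_sweep hθ hg hF v)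
    (h.differentiableAt (contMDiffAt_sweep hg hF) (0, v))] at h1
  have h2 : along₂ (sweep g F) (0 : DForm 4 2 M) (1, 0) (0, v) (0, x) = 0 := rfl
  rw [h2] at h1
  simpa using h1

theorem HasExtD.isLocallyConstant_flowVal [IsManifold (𝓡 4) ∞ M] {θ : DForm 4 1 M} (h : HasExtD θ 0)
    (hθ : ∀ c : G, pullback (m := 4) (fun p : M => c • p) θ = θ)
    (hg : ContMDiffAt 𝓘(ℝ, ℝ) (𝓡 d) 2 g 0) : IsLocallyConstant (flowVal g θ : M → ℝ) := by
  refine (IsLocallyConstant.iff_eventually_eq _).2 fun p => ?_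
  set ch := chartAt (E 4) p
  obtain ⟨ε, hε, hball⟩ := Metric.isOpen_iff.1 ch.open_target _ (mem_chart_target (E 4) p)
  have hd : ∀ y ∈ Metric.ball (ch p) ε,
      HasFDerivAt (fun y => flowVal g θ (ch.symm y)) (0 : E 4 →L[ℝ] ℝ) y := fun y hy =>
    h.hasFDerivAt_flowVal_zero hθ hg (contMDiffAt_chart_symm p (hball hy))
  have hc : ContinuousAt ch p := ch.continuousAt (mem_chart_source (E 4) p)
  filter_upwards [ch.open_source.mem_nhds (mem_chart_source (E 4) p),
    hc.eventually (Metric.ball_mem_nhds _ hε)] with q hq1 hq2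
  have h1 := Metric.isOpen_ball.is_const_of_fderiv_eq_zero (𝕜 := ℝ)
    (convex_ball (ch p) ε).isPreconnected
    (fun y hy => (hd y hy).differentiableAt.differentiableWithinAt)
    (fun y hy => (hd y hy).fderiv) hq2 (Metric.mem_ball_self hε)
  simpa [ch.left_inv hq1, ch.left_inv (mem_chart_source (E 4) p)] using h1

end Curves

/-! ### Stokes' theorem on a strip of circle fibres -/

section Strip

variable {M : Type*} [TopologicalSpace M] [ChartedSpace (E 4) M]
  {d : ℕ} {G : Type*} [Group G] [TopologicalSpace G] [ChartedSpace (E d) G]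
  [MulAction G M] [ContMDiffSMul (𝓡 d) (𝓡 4) ∞ G M]
  {V : Type} [NormedAddCommGroup V] [NormedSpace ℝ V]

theorem along_sweep_zero {g : ℝ → G} {F : V → M} {x : V}
    (hg : ContMDiffAt 𝓘(ℝ, ℝ) (𝓡 d) 2 g 0) (hg0 : g 0 = 1)
    (hF : ContMDiffAt 𝓘(ℝ, V) (𝓡 4) 2 F x) (θ : DForm 4 1 M) (v : V) :
    along (sweep g F) θ (0, v) (0, x) = along F θ v x := by
  have h := dAlong_snd (m := 4) ((contMDiffAt_sweep hg hF).mdifferentiableAt (by simp)) v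
  have h0 : (fun y => sweep g F (0, y)) = F := by
    funext y
    simp [sweep, hg0]
  have h1 : along (fun y => sweep g F (0, y)) θ v x = along (sweep g F) θ (0, v) (0, x) := by
    simp only [along]
    rw [h]
  rw [← h1, h0]

/-- Evaluate `dΩ = k c∧Ω` on `X, v, w`. Invariance removes the derivative of `Ω(v, w)` along `X`,
and `c(v) = c(w) = 0` leaves only the term `k c(X) Ω(v, w)`. This is `d(i_X Ω) = -k c(X) Ω` on a
surface tangent to `ker c`. -/
theorem IsLcsCoframe.exists_divergence_eq [IsManifold (𝓡 4) ∞ M] {k r : ℝ} {a b c e : DForm 4 1 M}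
    (h : IsLcsCoframe k r a b c e) {t₁ t₂ t₃ : ℝ}
    (hΩ : ∀ q : G, pullback (m := 4) (fun p : M => q • p) (lcsForm k r a b c e t₁ t₂ t₃) =
      lcsForm k r a b c e t₁ t₂ t₃)
    {g : ℝ → G} (hg : ContMDiffAt 𝓘(ℝ, ℝ) (𝓡 d) 2 g 0) (hg0 : g 0 = 1)
    {F : V → M} {x : V} (hF : ContMDiffAt 𝓘(ℝ, V) (𝓡 4) 2 F x) {v w : V}
    (hcv : along F c v x = 0) (hcw : along F c w x = 0) :
    ∃ A B : V →L[ℝ] ℝ,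
      HasFDerivAt (fun y => along₂ (sweep g F) (lcsForm k r a b c e t₁ t₂ t₃) (1, 0) (0, v) (0, y))
        A x ∧
      HasFDerivAt (fun y => along₂ (sweep g F) (lcsForm k r a b c e t₁ t₂ t₃) (1, 0) (0, w) (0, y))
        B x ∧
      A w - B v = k * flowVal g c (F x) * along₂ F (lcsForm k r a b c e t₁ t₂ t₃) v w x := by
  set Ω := lcsForm k r a b c e t₁ t₂ t₃ with hΩdef
  have hS := contMDiffAt_sweep hg hF
  have hd : ∀ p q, DifferentiableAt ℝ (along₂ (sweep g F) Ω p q) (0, x) := fun p q =>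
    (h.hasFDerivAt hS t₁ t₂ t₃ p q).differentiableAt
  have hK := h.cyclicDeriv_eq hS t₁ t₂ t₃ (1, 0) (0, v) (0, w)
  have hev := eventually_along₂_sweep hΩ hg hF v w
  have hneg : along₂ (sweep g F) Ω (0, w) (1, 0) = -along₂ (sweep g F) Ω (1, 0) (0, w) := by
    funext y
    simp only [hΩdef, along₂_lcsForm, along₂_wedge, Pi.neg_apply]
    ring
  rw [← hΩdef] at hK
  simp only [cyclicDeriv, cyclicProd, along_sweep_zero hg hg0 hF, hcv, hcw,
    fderiv_inl_eq_zero hev (hd _ _), hneg, ← flowVal_comp hg hF, hev.self_of_nhds] at hK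
  rw [fderiv_neg] at hK
  refine ⟨_, _, (hd _ _).hasFDerivAt.comp x (hasFDerivAt_prodMk_right 0 x),
    (hd _ _).hasFDerivAt.comp x (hasFDerivAt_prodMk_right 0 x), ?_⟩
  simp at hK ⊢
  linarith

/-- `F` is a map of class `C²` along `{s} × ℝ` whose partial derivatives are dual to `a` (up to
multiples of the vector dual to `e`) and dual to `e`. -/
structure IsFlowStrip (a b c e : DForm 4 1 M) (F : ℝ × ℝ → M) (s : ℝ) : Prop where
  contMDiffAt : ∀ t, ContMDiffAt 𝓘(ℝ, ℝ × ℝ) (𝓡 4) 2 F (s, t)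
  a_fst : ∀ t, along F a (1, 0) (s, t) = 1
  b_fst : ∀ t, along F b (1, 0) (s, t) = 0
  c_fst : ∀ t, along F c (1, 0) (s, t) = 0
  a_snd : ∀ t, along F a (0, 1) (s, t) = 0
  b_snd : ∀ t, along F b (0, 1) (s, t) = 0
  c_snd : ∀ t, along F c (0, 1) (s, t) = 0
  e_snd : ∀ t, along F e (0, 1) (s, t) = 1

theorem along_periodic {F : ℝ × ℝ → M} (hper : ∀ s t, F (s, t + 1) = F (s, t)) {s t : ℝ}
    (hF : ContMDiffAt 𝓘(ℝ, ℝ × ℝ) (𝓡 4) 2 F (s, t + 1)) (θ : DForm 4 1 M) (v : ℝ × ℝ) :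
    along F θ v (s, t + 1) = along F θ v (s, t) := by
  have hτ : HasFDerivAt (fun y : ℝ × ℝ => (y.1, y.2 + 1)) 
      ((ContinuousLinearMap.fst ℝ ℝ ℝ).prod (.snd ℝ ℝ ℝ)) (s, t) :=
    (hasFDerivAt_fst (𝕜 := ℝ)).prodMk ((hasFDerivAt_snd (𝕜 := ℝ)).add_const (1 : ℝ))
  have h1 : F ∘ (fun y : ℝ × ℝ => (y.1, y.2 + 1)) = F := by
    funext y
    exact hper y.1 y.2
  have h2 := dAlong_comp_right (m := 4) (Φ := F) 
    (i := fun y : ℝ × ℝ => (y.1, y.2 + 1)) (hF.mdifferentiableAt (by simp)) hτ v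
  have h3 : along (F ∘ (fun y : ℝ × ℝ => (y.1, y.2 + 1))) θ v (s, t) =
      along F θ v (s, t + 1) := by
    simp only [along]
    rw [h2]
    rfl
  rw [← h3, h1]

/-- On the strip `Ω(∂_s, ∂_t) = t₁` and `Ω(X, ∂_t) = t₁ a(X) - k t₃ c(X)`. The multiples of the
vertical vector that `∂_s` may contain do not enter either of these values, so no horizontal lift is
required. -/
theorem IsLcsCoframe.integral_flowVal_sub [IsManifold (𝓡 4) ∞ M] {k r : ℝ} {a b c e : DForm 4 1 M}
    (h : IsLcsCoframe k r a b c e) {t₁ t₂ t₃ : ℝ}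
    (hΩ : ∀ q : G, pullback (m := 4) (fun p : M => q • p) (lcsForm k r a b c e t₁ t₂ t₃) =
      lcsForm k r a b c e t₁ t₂ t₃)
    {g : ℝ → G} (hg : ContMDiffAt 𝓘(ℝ, ℝ) (𝓡 d) 2 g 0) (hg0 : g 0 = 1)
    {y : ℝ} (hy : ∀ p : M, flowVal g c p = y)
    {F : ℝ × ℝ → M} (hper : ∀ s t, F (s, t + 1) = F (s, t)) {J : Set ℝ} [J.OrdConnected]
    (hF : ∀ s ∈ J, IsFlowStrip a b c e F s) {s₁ s₂ : ℝ} (h₁ : s₁ ∈ J) (h₂ : s₂ ∈ J) :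
    (∫ t in (0 : ℝ)..1, t₁ * flowVal g a (F (s₂, t)) - k * t₃ * flowVal g c (F (s₂, t))) -
      ∫ t in (0 : ℝ)..1, t₁ * flowVal g a (F (s₁, t)) - k * t₃ * flowVal g c (F (s₁, t)) =
    -(k * y * t₁) * (s₂ - s₁) := by
  set Ω := lcsForm k r a b c e t₁ t₂ t₃ with hΩdef
  have hu : ∀ s ∈ J, ∀ t, ∀ θ : DForm 4 1 M,
      along (sweep g F) θ (1, 0) (0, (s, t)) = flowVal g θ (F (s, t)) := fun s hs t θ =>
    (flowVal_comp hg ((hF s hs).contMDiffAt t) θ).symm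
  have hv : ∀ s ∈ J, ∀ t, ∀ (θ : DForm 4 1 M) (v : ℝ × ℝ),
      along (sweep g F) θ (0, v) (0, (s, t)) = along F θ v (s, t) := fun s hs t θ v =>
    along_sweep_zero hg hg0 ((hF s hs).contMDiffAt t) θ v
  have hB : ∀ s ∈ J, ∀ t, along₂ (sweep g F) Ω (1, 0) (0, (0, 1)) (0, (s, t)) =
      t₁ * flowVal g a (F (s, t)) - k * t₃ * flowVal g c (F (s, t)) := fun s hs t => by
    have H := hF s hs
    simp only [hΩdef, along₂_lcsForm, along₂_wedge, hu s hs, hv s hs, H.a_snd, H.b_snd, H.c_snd,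
      H.e_snd]
    ring
  have hA : ∀ s ∈ J, along₂ (sweep g F) Ω (1, 0) (0, (1, 0)) (0, (s, 1)) =
      along₂ (sweep g F) Ω (1, 0) (0, (1, 0)) (0, (s, 0)) := fun s hs => by
    have H := hF s hs
    have hp := hper s 0
    have hp' := fun θ => along_periodic hper (H.contMDiffAt (0 + 1)) θ (1, 0)
    rw [zero_add] at hp
    simp only [zero_add] at hp'
    simp only [hΩdef, along₂_lcsForm, along₂_wedge, hu s hs, hv s hs, hp, hp']
  have hC : ∀ s ∈ J, ∀ t, along₂ F Ω (1, 0) (0, 1) (s, t) = t₁ := fun s hs t => by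
    have H := hF s hs
    simp only [hΩdef, along₂_lcsForm, along₂_wedge, H.a_snd, H.b_snd, H.c_snd,
      H.e_snd, H.a_fst, H.b_fst, H.c_fst]
    ring
  -- The divergence theorem takes derivatives given as functions on the whole plane. Over points
  -- outside `J` the value `0` is only a filler.
  have hdiv : ∀ x : ℝ × ℝ, ∃ A B : ℝ × ℝ →L[ℝ] ℝ, x.1 ∈ J →
      HasFDerivAt (fun y => along₂ (sweep g F) Ω (1, 0) (0, (1, 0)) (0, y)) A x ∧
      HasFDerivAt (fun y => along₂ (sweep g F) Ω (1, 0) (0, (0, 1)) (0, y)) B x ∧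
      A (0, 1) - B (1, 0) = k * y * t₁ := by
    rintro ⟨s, t⟩
    by_cases hs : s ∈ J
    · have H := hF s hs
      obtain ⟨A, B, h1, h2, h3⟩ := h.exists_divergence_eq (t₁ := t₁) (t₂ := t₂) (t₃ := t₃)
        (v := (1, 0)) (w := (0, 1)) hΩ hg hg0 (H.contMDiffAt t) (H.c_fst t) (H.c_snd t)
      rw [← hΩdef] at h1 h2 h3
      rw [hC s hs, hy] at h3
      exact ⟨A, B, fun _ => ⟨h1, h2, h3⟩⟩
    · exact ⟨0, 0, fun h => absurd h hs⟩
  choose A B hAB using hdiv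
  have hJ : uIcc s₁ s₂ ⊆ J := Set.OrdConnected.uIcc_subset ‹_› h₁ h₂
  have hmem : ∀ x ∈ Ioo (min s₁ s₂) (max s₁ s₂) ×ˢ Ioo (min (0 : ℝ) 1) (max 0 1), x.1 ∈ J :=
    fun x hx => hJ (Ioo_subset_Icc_self hx.1)
  have hint : EqOn (fun x : ℝ × ℝ => (-B x) (1, 0) + A x (0, 1)) (fun _ => k * y * t₁)
      (uIcc s₁ s₂ ×ˢ uIcc (0 : ℝ) 1) := fun x hx => by
    have := (hAB x (hJ hx.1)).2.2
    simp only [neg_apply]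
    linarith
  have hms : MeasurableSet (uIcc s₁ s₂ ×ˢ uIcc (0 : ℝ) 1) :=
    measurableSet_uIcc.prod measurableSet_uIcc
  -- The plane vector field `(-Ω(X, ∂_t), Ω(X, ∂_s))` has constant divergence `k y t₁`.
  have key := MeasureTheory.integral2_divergence_prod_of_hasFDerivAt
    (fun y => -along₂ (sweep g F) Ω (1, 0) (0, (0, 1)) (0, y))
    (fun y => along₂ (sweep g F) Ω (1, 0) (0, (1, 0)) (0, y)) (fun x => -B x) A s₁ 0 s₂ 1
    (fun x hx => ((hAB x (hJ hx.1)).2.1.neg).continuousAt.continuousWithinAt)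
    (fun x hx => (hAB x (hJ hx.1)).1.continuousAt.continuousWithinAt)
    (fun x hx => (hAB x (hmem x hx)).2.1.neg) (fun x hx => (hAB x (hmem x hx)).1)
    (by
      rw [MeasureTheory.integrableOn_congr_fun hint hms]
      exact (continuous_const.continuousOn).integrableOn_compact
        (isCompact_uIcc.prod isCompact_uIcc))
  have hL : (∫ s in s₁..s₂, ∫ t in (0 : ℝ)..1, (-B (s, t)) (1, 0) + A (s, t) (0, 1)) =
      (s₂ - s₁) * (k * y * t₁) := by
    have h1 : EqOn (fun s => ∫ t in (0 : ℝ)..1, (-B (s, t)) (1, 0) + A (s, t) (0, 1))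
        (fun _ => k * y * t₁) (uIcc s₁ s₂) := fun s hs => by
      have h2 : EqOn (fun t => (-B (s, t)) (1, 0) + A (s, t) (0, 1)) (fun _ => k * y * t₁)
          (uIcc 0 1) := fun t ht => hint (x := (s, t)) ⟨hs, ht⟩
      refine (intervalIntegral.integral_congr h2).trans ?_
      simp
    rw [intervalIntegral.integral_congr h1, intervalIntegral.integral_const, smul_eq_mul]
  -- The edges `t = 0` and `t = 1` of the rectangle have the same image, so their contributions
  -- cancel.
  have hG : (∫ s in s₁..s₂, along₂ (sweep g F) Ω (1, 0) (0, (1, 0)) (0, (s, 1))) =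
      ∫ s in s₁..s₂, along₂ (sweep g F) Ω (1, 0) (0, (1, 0)) (0, (s, 0)) :=
    intervalIntegral.integral_congr fun s hs => hA s (hJ hs)
  rw [hL, hG] at key
  simp only [hB s₁ h₁, hB s₂ h₂, intervalIntegral.integral_neg] at key
  linarith

end Strip

/-! ### Boundedness forces `c(X) = 0` -/

section Global

theorem eq_zero_of_bounded_of_affine {f : ℝ → ℝ} {y C : ℝ} (hf : ∀ s, f s = f 0 + y * s)
    (hC : ∀ s, |f s| ≤ C) : y = 0 := by
  by_contra h
  -- At this point `f` takes the value `f 0 + |f 0| + 2C + 1 ≥ 2C + 1`, which exceeds `C` because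
  -- the bound at `0` gives `C ≥ 0`.
  have h1 := hC ((2 * C + 1 + |f 0|) / y)
  rw [hf, mul_div_cancel₀ _ h] at h1
  have h2 := hC 0
  grind

theorem affine_of_locally_affine {f : ℝ → ℝ} {y : ℝ}
    (hf : ∀ s₀, ∃ ε > 0, ∀ s ∈ Metric.ball s₀ ε, f s - f s₀ = y * (s - s₀)) (s : ℝ) :
    f s = f 0 + y * s := by
  have h : IsLocallyConstant fun s => f s - y * s := by
    refine (IsLocallyConstant.iff_eventually_eq _).2 fun s₀ => ?_
    obtain ⟨ε, hε, h⟩ := hf s₀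
    filter_upwards [Metric.ball_mem_nhds s₀ hε] with s hs
    linarith [h s hs]
  have := h.apply_eq_of_preconnectedSpace s 0
  simp only [mul_zero, sub_zero] at this
  linarith

/-- With `z = exp(iτ)`, multiplying by `z` shifts the parameter by `τ / 2π`, which does not change
the integral of a function of period `1` over a period. The integral over a fibre is thus
independent of the starting point, and integrals from different local strips can be compared. -/
theorem integral_circle_eq {M : Type*} [MulAction Circle M] {f : M → ℝ} {F : ℝ → M} {p : M} {z : Circle}
    (hF : ∀ t : ℝ, F t = (Circle.exp (2 * Real.pi * t) * z) • p) :
    ∫ t in (0 : ℝ)..1, f (F t) =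
      ∫ t in (0 : ℝ)..1, f (Circle.exp (2 * Real.pi * t) • p) := by
  obtain ⟨τ, hτ⟩ := Circle.exp_surjective z
  have hπ : 2 * Real.pi ≠ 0 := by positivity
  have h1 : ∀ t : ℝ, f (F t) = f (Circle.exp (2 * Real.pi * (t + τ / (2 * Real.pi))) • p) := by
    intro t
    rw [hF, ← hτ, ← Circle.exp_add]
    congr 4
    field_simp
  have hper : Function.Periodic (fun t : ℝ => f (Circle.exp (2 * Real.pi * t) • p)) 1 := by
    intro t
    simp only [mul_add, mul_one, Circle.exp_add, Circle.exp_two_pi]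
  simp only [h1]
  rw [intervalIntegral.integral_comp_add_right
    (fun t => f (Circle.exp (2 * Real.pi * t) • p))]
  have := hper.intervalIntegral_add_eq (τ / (2 * Real.pi)) 0
  rw [zero_add] at this
  rwa [zero_add, add_comm (1 : ℝ)]

variable {M : Type*} [TopologicalSpace M] [ChartedSpace (E 4) M]
  {d : ℕ} {G : Type*} [Group G] [TopologicalSpace G] [ChartedSpace (E d) G]
  [MulAction G M] [ContMDiffSMul (𝓡 d) (𝓡 4) ∞ G M] [MulAction Circle M]

/-- On a compact connected manifold with an invariant form `Ω = t₁ a∧e + ⋯`, `dΩ = k c ∧ Ω`,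
the form `c` vanishes on the vector fields of the action, if the vector field dual to `a` lifts
a flow to a circle bundle with vertical vector field dual to `e`. -/
theorem IsLcsCoframe.flowVal_lee_eq_zero [IsManifold (𝓡 4) ∞ M] [CompactSpace M]
    [PreconnectedSpace M] {k r : ℝ} {a b c e : DForm 4 1 M}
    (h : IsLcsCoframe k r a b c e) (hk : k ≠ 0) {t₁ t₂ t₃ : ℝ} (ht : t₁ * t₂ ≠ 0)
    (ht' : t₁ * t₂ ≠ r * k * t₃ ^ 2)
    (hΩ : ∀ q : G, pullback (m := 4) (fun p : M => q • p) (lcsForm k r a b c e t₁ t₂ t₃) =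
      lcsForm k r a b c e t₁ t₂ t₃)
    {P : ℝ → M} (hP : ∀ s₀ : ℝ, ∃ ε > 0, ∃ F : ℝ × ℝ → M, (∀ s t, F (s, t + 1) = F (s, t)) ∧
      ∀ s ∈ Metric.ball s₀ ε, IsFlowStrip a b c e F s ∧
        ∃ z : Circle, ∀ t, F (s, t) = (Circle.exp (2 * Real.pi * t) * z) • P s)
    {g : ℝ → G} (hg : ContMDiffAt 𝓘(ℝ, ℝ) (𝓡 d) 2 g 0) (hg0 : g 0 = 1) (p : M) :
    flowVal g c p = 0 := by
  have hc : ∀ q : G, pullback (m := 4) (fun p : M => q • p) c = c := fun q =>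
    h.pullback_lee hk ht ht' (contMDiff_smul_two d q) (hΩ q)
  have hconst : ∀ q : M, flowVal g c q = flowVal g c p := fun q =>
    (h.dc.isLocallyConstant_flowVal hc hg).apply_eq_of_preconnectedSpace q p
  set f : M → ℝ := fun q => t₁ * flowVal g a q - k * t₃ * flowVal g c q with hf
  have hcont : Continuous f :=
    ((h.da.continuous_flowVal hg).const_mul t₁).sub
      ((h.dc.continuous_flowVal hg).const_mul (k * t₃))
  obtain ⟨C, hC⟩ := isCompact_univ.exists_bound_of_continuousOn hcont.continuousOn
  -- Strips exist only near each `s₀`, but the integral over the whole fibre through `P s` is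
  -- defined for all `s`. No continuity of `P` is needed.
  set A : ℝ → ℝ := fun s => ∫ t in (0 : ℝ)..1, f (Circle.exp (2 * Real.pi * t) • P s) with hA
  have hbound : ∀ s, |A s| ≤ C := fun s => by
    have := intervalIntegral.norm_integral_le_of_norm_le_const (a := (0 : ℝ)) (b := 1) (C := C)
      (f := fun t => f (Circle.exp (2 * Real.pi * t) • P s)) fun t _ => hC _ (mem_univ _)
    simpa using this
  have haff : ∀ s, A s = A 0 + -(k * flowVal g c p * t₁) * s := by
    refine affine_of_locally_affine fun s₀ => ?_
    obtain ⟨ε, hε, F, hper, hF⟩ := hP s₀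
    refine ⟨ε, hε, fun s hs => ?_⟩
    have : (Metric.ball s₀ ε).OrdConnected := (convex_ball s₀ ε).ordConnected
    have hs₀ : s₀ ∈ Metric.ball s₀ ε := Metric.mem_ball_self hε
    have key := h.integral_flowVal_sub hΩ hg hg0 hconst hper (J := Metric.ball s₀ ε)
      (fun s hs => (hF s hs).1) hs₀ hs
    have e1 : ∀ s ∈ Metric.ball s₀ ε, A s = ∫ t in (0 : ℝ)..1, f (F (s, t)) := fun s hs => by
      obtain ⟨z, hz⟩ := (hF s hs).2
      exact (integral_circle_eq (f := f) (F := fun t => F (s, t)) hz).symm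
    rw [e1 s hs, e1 s₀ hs₀]
    exact key
  have h0 := eq_zero_of_bounded_of_affine haff hbound
  have ht₁ : t₁ ≠ 0 := left_ne_zero_of_mul ht
  simpa [hk, ht₁] using h0

end Global

/-! ### Primitives of an invariant form along orbits -/

section Orbit

theorem countable_range_of_isLocallyConstant {X Y : Type*} [TopologicalSpace X]
    [SecondCountableTopology X] {f : X → Y} (hf : IsLocallyConstant f) : (range f).Countable := by
  obtain ⟨s, hs, hcov⟩ := TopologicalSpace.countable_cover_nhds
    (f := fun x => {y | f y = f x}) fun x => (IsLocallyConstant.iff_eventually_eq f).1 hf x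
  refine (hs.image f).mono ?_
  rintro _ ⟨y, rfl⟩
  obtain ⟨x, hx, hy⟩ := mem_iUnion₂.1 (hcov.ge (mem_univ y))
  exact ⟨x, hx, Eq.symm hy⟩

/-- `z` is a primitive of the `1`-form `c` on `U`. -/
def IsPrimitiveOn {m : ℕ} {M : Type*} [TopologicalSpace M] [ChartedSpace (E m) M] (z : M → ℝ)
    (c : DForm m 1 M) (U : Set M) : Prop :=
  ∀ (V : Type) [NormedAddCommGroup V] [NormedSpace ℝ V] (F : V → M) (x : V),
    ContMDiffAt 𝓘(ℝ, V) (𝓡 m) 2 F x → F x ∈ U →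
      DifferentiableAt ℝ (z ∘ F) x ∧ ∀ v, fderiv ℝ (z ∘ F) x v = along F c v x

theorem contMDiff_smul_const {M : Type*} [TopologicalSpace M] [ChartedSpace (E 4) M] (d : ℕ)
    {G : Type*} [Group G] [TopologicalSpace G] [ChartedSpace (E d) G] [MulAction G M]
    [ContMDiffSMul (𝓡 d) (𝓡 4) ∞ G M] (p : M) : ContMDiff (𝓡 d) (𝓡 4) 2 (fun q : G => q • p) := by
  have : ContMDiffSMul (𝓡 d) (𝓡 4) 2 G M := ContMDiffSMul.of_le two_le_infty
  exact contMDiff_id.smul contMDiff_const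

variable {M : Type*} [TopologicalSpace M] [ChartedSpace (E 4) M]
  {d : ℕ} {G : Type*} [Group G] [TopologicalSpace G] [ChartedSpace (E d) G]
  [LieGroup (𝓡 d) ∞ G] [MulAction G M] [ContMDiffSMul (𝓡 d) (𝓡 4) ∞ G M]

/-- If an invariant `1`-form vanishes on the vector fields of the action, then it vanishes on the
orbits. -/
theorem along_orbit_eq_zero {c : DForm 4 1 M} (hc : ∀ q : G, pullback (m := 4)
      (fun p : M => q • p) c = c) {p : M}
    (hp : ∀ g : ℝ → G, ContMDiffAt 𝓘(ℝ, ℝ) (𝓡 d) 2 g 0 → g 0 = 1 → flowVal g c p = 0)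
    {V : Type} [NormedAddCommGroup V] [NormedSpace ℝ V] {κ : V → G} {y : V}
    (hκ : ContMDiffAt 𝓘(ℝ, V) (𝓡 d) 2 κ y) (w : V) : along (fun y => κ y • p) c w y = 0 := by
  have : LieGroup (𝓡 d) 2 G := LieGroup.of_le (n := ∞) two_le_infty
  set l : ℝ → V := fun u => y + u • w with hl
  have hl0 : l 0 = y := by simp [hl]
  have hlC : ContDiff ℝ 2 l := by fun_prop
  have hl' : HasFDerivAt l ((ContinuousLinearMap.id ℝ ℝ).smulRight w) 0 :=
    ((hasFDerivAt_id (𝕜 := ℝ) (0 : ℝ)).smul_const w).const_add y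
  set g : ℝ → G := fun u => (κ y)⁻¹ * κ (l u) with hgdef
  have hg : ContMDiffAt 𝓘(ℝ, ℝ) (𝓡 d) 2 g 0 := by
    refine contMDiffAt_const.mul (ContMDiffAt.comp (0 : ℝ) ?_ hlC.contMDiff.contMDiffAt)
    rwa [hl0]
  have hg0 : g 0 = 1 := by simp [hgdef, hl0]
  have hκp : ContMDiffAt 𝓘(ℝ, V) (𝓡 4) 2 (fun y => κ y • p) y :=
    (contMDiff_smul_const d p _).comp y hκ
  have hgp : ContMDiffAt 𝓘(ℝ, ℝ) (𝓡 4) 2 (fun u => g u • p) 0 :=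
    (contMDiff_smul_const d p _).comp 0 hg
  have h1 : (fun y => κ y • p) ∘ l = (fun q : M => κ y • q) ∘ fun u => g u • p := by
    funext u
    simp [hgdef, smul_smul]
  have h2 := along_pullback (m := 4) (m' := 4) (F := fun u : ℝ => g u • p) (x := 0)
    ((contMDiff_smul_two d (κ y)).mdifferentiable (by simp) (g 0 • p))
    (hgp.mdifferentiableAt (by simp)) c 1
  rw [hc, ← h1] at h2
  have h3 : flowVal g c p = along (fun u => g u • p) c 1 0 := rfl
  rw [← h3, hp g hg hg0] at h2
  have h4 := dAlong_comp_right (m := 4) (Φ := fun y => κ y • p) (i := l) (y := 0)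
    (by rw [hl0]; exact hκp.mdifferentiableAt (by simp)) hl' 1
  have h5 : along ((fun y => κ y • p) ∘ l) c 1 0 = along (fun y => κ y • p) c w (l 0) := by
    simp only [along]
    rw [h4]
    simp
  rw [← hl0, ← h5, ← h2]

/-- On the open set of `q : G` with `q • p ∈ U`, the function `q ↦ z (q • p)` has derivative `0` in
charts, since `c` vanishes along the orbit. It is locally constant there, so it has countable range,
and by transitivity this range is all of `z '' U`. -/
theorem countable_image_primitive [SecondCountableTopology G] [MulAction.IsPretransitive G M]
    {c : DForm 4 1 M} (hc : ∀ q : G, pullback (m := 4) (fun p : M => q • p) c = c) {p : M}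
    (hp : ∀ g : ℝ → G, ContMDiffAt 𝓘(ℝ, ℝ) (𝓡 d) 2 g 0 → g 0 = 1 → flowVal g c p = 0)
    {z : M → ℝ} {U : Set M} (hU : IsOpen U) (hz : IsPrimitiveOn z c U) : (z '' U).Countable := by
  have hcont : Continuous fun q : G => q • p := (contMDiff_smul_const d p).continuous
  have hS : IsOpen ((fun q : G => q • p) ⁻¹' U) := hU.preimage hcont
  have hlc : IsLocallyConstant fun q : (fun q : G => q • p) ⁻¹' U => z (q.1 • p) := by
    refine (IsLocallyConstant.iff_eventually_eq _).2 fun q₀ => ?_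
    set ch := chartAt (E d) q₀.1
    have hq₀ : q₀.1 ∈ ch.source := mem_chart_source _ _
    have hopen : IsOpen (ch.target ∩ ch.symm ⁻¹' ((fun q : G => q • p) ⁻¹' U)) :=
      ch.isOpen_inter_preimage_symm hS
    obtain ⟨ε, hε, hball⟩ := Metric.isOpen_iff.1 hopen (ch q₀.1)
      ⟨ch.map_source hq₀, by
        change ch.symm (ch q₀.1) • p ∈ U
        rw [ch.left_inv hq₀]
        exact q₀.2⟩
    have hC : ∀ y ∈ Metric.ball (ch q₀.1) ε, ContMDiffAt 𝓘(ℝ, E d) (𝓡 d) 2 ch.symm y :=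
      fun y hy => ((contMDiffOn_symm_of_mem_maximalAtlas (I := 𝓡 d) (n := ∞)
        (IsManifold.chart_mem_maximalAtlas q₀.1)).contMDiffAt
          (ch.open_target.mem_nhds (hball hy).1)).of_le two_le_infty
    have hF : ∀ y ∈ Metric.ball (ch q₀.1) ε,
        ContMDiffAt 𝓘(ℝ, E d) (𝓡 4) 2 (fun y => ch.symm y • p) y := fun y hy =>
      (contMDiff_smul_const d p _).comp y (hC y hy)
    have hd : ∀ y ∈ Metric.ball (ch q₀.1) ε,
        DifferentiableAt ℝ (z ∘ fun y => ch.symm y • p) y ∧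
          fderiv ℝ (z ∘ fun y => ch.symm y • p) y = 0 := fun y hy => by
      obtain ⟨h1, h2⟩ := hz (E d) (fun y => ch.symm y • p) y (hF y hy) (hball hy).2
      refine ⟨h1, ?_⟩
      ext w
      rw [h2, along_orbit_eq_zero hc hp (hC y hy)]
      rfl
    have hcc : ContinuousAt (fun q : (fun q : G => q • p) ⁻¹' U => ch q.1) q₀ :=
      (ch.continuousAt hq₀).comp continuousAt_subtype_val
    filter_upwards [continuousAt_subtype_val.eventually (ch.open_source.mem_nhds hq₀),
      hcc.eventually (Metric.ball_mem_nhds _ hε)] with q h1 h2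
    have h3 := Metric.isOpen_ball.is_const_of_fderiv_eq_zero (𝕜 := ℝ)
      (convex_ball (ch q₀.1) ε).isPreconnected
      (fun y hy => (hd y hy).1.differentiableWithinAt)
      (fun y hy => (hd y hy).2) h2 (Metric.mem_ball_self hε)
    simpa [ch.left_inv h1, ch.left_inv hq₀] using h3
  refine (countable_range_of_isLocallyConstant hlc).mono ?_
  rintro _ ⟨q, hq, rfl⟩
  obtain ⟨g, rfl⟩ := MulAction.exists_smul_eq G p q
  exact ⟨⟨g, hq⟩, rfl⟩

end Orbit

/-! ### Compactness and connectedness of circle bundles -/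

section BundleTopology

variable {M N : Type*} [TopologicalSpace M] [TopologicalSpace N] {π : M → N}

theorem continuous_trivialization_fiber (e : Bundle.Trivialization Circle π) {b : N}
    (hb : b ∈ e.baseSet) :
    Continuous fun w : Circle => e.toOpenPartialHomeomorph.symm (b, w) := by
  refine continuous_iff_continuousAt.2 fun w => ?_
  have h : (b, w) ∈ e.target := e.mem_target.2 hb
  exact ContinuousAt.comp (f := fun w : Circle => (b, w))
    (e.toOpenPartialHomeomorph.symm.continuousAt h) (by fun_prop)

/-- Finitely many compact sets, each inside the base of a trivialization, cover `N`; their preimages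
are images of compact products with the circle. -/
theorem compactSpace_of_circleBundle [CompactSpace N] [LocallyCompactSpace N]
    (hπ : ∀ b : N, ∃ e : Bundle.Trivialization Circle π, b ∈ e.baseSet) : CompactSpace M := by
  choose e he using hπ
  have h : ∀ b, ∃ K ∈ 𝓝 b, K ⊆ (e b).baseSet ∧ IsCompact K := fun b =>
    local_compact_nhds ((e b).open_baseSet.mem_nhds (he b))
  choose K hK hKs hKc using h
  obtain ⟨s, hs⟩ := CompactSpace.elim_nhds_subcover K hK
  have hcomp : ∀ b, IsCompact ((e b).toOpenPartialHomeomorph.symm '' (K b ×ˢ univ)) := fun b =>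
    ((hKc b).prod isCompact_univ).image_of_continuousOn
      ((e b).toOpenPartialHomeomorph.symm.continuousOn.mono fun x hx =>
        (e b).mem_target.2 (hKs b hx.1))
  refine ⟨?_⟩
  convert s.isCompact_biUnion fun b _ => hcomp b
  refine (eq_univ_of_forall fun p => ?_).symm
  have hp : π p ∈ ⋃ x ∈ s, K x := hs.symm ▸ mem_univ _
  obtain ⟨b, hb, hpb⟩ := mem_iUnion₂.1 hp
  refine mem_iUnion₂.2 ⟨b, hb, (π p, (e b p).2), ⟨hpb, mem_univ _⟩, ?_⟩
  exact (e b).symm_apply_mk_proj ((e b).mem_source.2 (hKs b hpb))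

/-- A continuous map `f : M → Bool` is constant on the connected fibres, so it descends to the base.
The choice `σ` of points in the fibres may be discontinuous: near each point it can be replaced,
without changing `f`, by a section from a trivialization. -/
theorem preconnectedSpace_of_circleBundle {X : Type*} [TopologicalSpace X] [PreconnectedSpace X]
    {ρ : X → N} (hρ : Continuous ρ) (hρs : Function.Surjective ρ)
    (hπ : ∀ b : N, ∃ e : Bundle.Trivialization Circle π, b ∈ e.baseSet) :
    PreconnectedSpace M := by
  have hfib : ∀ f : M → Bool, Continuous f → ∀ b, ∀ e : Bundle.Trivialization Circle π,
      b ∈ e.baseSet → ∀ p, π p = b → f p = f (e.toOpenPartialHomeomorph.symm (b, 1)) := by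
    rintro f hf b e hb p rfl
    have h1 := PreconnectedSpace.constant (α := Circle) inferInstance
      (hf.comp (continuous_trivialization_fiber e hb)) (x := (e p).2) (y := 1)
    simpa [e.symm_apply_mk_proj (e.mem_source.2 hb)] using h1
  have hsurj : ∀ b, ∃ p, π p = b := fun b => by
    obtain ⟨e, he⟩ := hπ b
    exact ⟨_, e.proj_symm_apply' (x := (1 : Circle)) he⟩
  choose σ hσ using hsurj
  refine preconnectedSpace_of_forall_constant fun f hf p q => ?_
  have hlc : IsLocallyConstant fun x : X => f (σ (ρ x)) := by
    refine (IsLocallyConstant.iff_continuous _).2 (continuous_iff_continuousAt.2 fun x => ?_)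
    obtain ⟨e, he⟩ := hπ (ρ x)
    have h1 : ContinuousAt (fun y : X => f (e.toOpenPartialHomeomorph.symm (ρ y, (1 : Circle)))) x := by
      have h2 : (ρ x, (1 : Circle)) ∈ e.target := e.mem_target.2 he
      exact hf.continuousAt.comp (ContinuousAt.comp (f := fun y : X => (ρ y, (1 : Circle)))
        (e.toOpenPartialHomeomorph.symm.continuousAt h2) (by fun_prop))
    refine h1.congr ?_
    filter_upwards [hρ.continuousAt.eventually (e.open_baseSet.mem_nhds he)] with y hy
    exact (hfib f hf _ e hy _ (hσ _)).symm
  have hval : ∀ p, ∃ x, f p = f (σ (ρ x)) := fun p => by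
    obtain ⟨x, hx⟩ := hρs (π p)
    obtain ⟨e, he⟩ := hπ (π p)
    refine ⟨x, ?_⟩
    rw [hx, hfib f hf _ e he p rfl, hfib f hf _ e he _ (hσ _)]
  obtain ⟨x, hx⟩ := hval p
  obtain ⟨y, hy⟩ := hval q
  rw [hx, hy]
  exact hlc.apply_eq_of_preconnectedSpace x y

end BundleTopology

/-! ### Coordinates, lifted curves and dual frames on the bundle -/

section CircleBundle

variable {k : ℝ} {Γ : Subgroup (Gk k)} [DiscreteTopology Γ]
  {M : Type*} [TopologicalSpace M] [ChartedSpace (E 4) M] [MulAction Circle M]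
  {π : M → Gk k ⧸ Γ}

theorem IsPrincipalCircleBundle.contMDiff {N : Type*} [TopologicalSpace N] [ChartedSpace (E 3) N]
    {π : M → N} (hπ : IsPrincipalCircleBundle π) : ContMDiff (𝓡 4) (𝓡 3) ∞ π := fun p => by
  obtain ⟨e, he, h1, -⟩ := hπ.locally_trivial (π p)
  have hs : e.source ∈ 𝓝 p := e.open_source.mem_nhds (e.mem_source.2 he)
  refine (contMDiffAt_fst.comp p (h1.contMDiffAt hs)).congr_of_eventuallyEq ?_
  filter_upwards [hs] with q hq
  exact (e.coe_fst hq).symm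

/-- The parametrization of a circle bundle over `G_k / Γ` by `G_k × ℝ` given by a local
trivialization. -/
noncomputable def bundleParam (e : Bundle.Trivialization Circle π) (z : Circle) (x : E 3 × ℝ) : M :=
  e.toOpenPartialHomeomorph.symm (proj Γ x.1, Circle.exp (2 * Real.pi * x.2) * z)

/-- The trivialization `e` is equivariant with smooth inverse. -/
structure IsEquivariantTrivialization (e : Bundle.Trivialization Circle π) : Prop where
  contMDiffOn_symm :
    ContMDiffOn ((𝓡 3).prod (𝓡 1)) (𝓡 4) ∞ e.toOpenPartialHomeomorph.symm e.target
  map_smul : ∀ c : Circle, ∀ p ∈ e.source, e (c • p) = ((e p).1, c * (e p).2)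

variable {e : Bundle.Trivialization Circle π} {z : Circle}

theorem trivialization_smul (hπ : IsPrincipalCircleBundle π) (he : IsEquivariantTrivialization e)
    {b : Gk k ⧸ Γ} (hb : b ∈ e.baseSet) (c w : Circle) :
    c • e.toOpenPartialHomeomorph.symm (b, w) = e.toOpenPartialHomeomorph.symm (b, c * w) := by
  have ht : ∀ w : Circle, (b, w) ∈ e.target := fun w => e.mem_target.2 hb
  have h1 : e.toOpenPartialHomeomorph.symm (b, w) ∈ e.source := e.map_target (ht w)
  have h2 : c • e.toOpenPartialHomeomorph.symm (b, w) ∈ e.source := by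
    rw [e.mem_source, hπ.map_smul, ← e.mem_source]
    exact h1
  have h3 := he.map_smul c _ h1
  rw [e.apply_symm_apply (ht w)] at h3
  have h4 := e.toOpenPartialHomeomorph.left_inv h2
  rw [← h4]
  exact congrArg _ h3

theorem contMDiffAt_bundleParam (he : IsEquivariantTrivialization e) {x : E 3 × ℝ}
    (hx : proj Γ x.1 ∈ e.baseSet) :
    ContMDiffAt 𝓘(ℝ, E 3 × ℝ) (𝓡 4) 2 (bundleParam e z) x := by
  have h1 : ContMDiffAt 𝓘(ℝ, E 3 × ℝ) (𝓡 3) ∞ (fun x : E 3 × ℝ => proj Γ x.1) x :=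
    (contMDiff_proj Γ _).comp x contDiff_fst.contMDiff.contMDiffAt
  have h2 : ContMDiffAt 𝓘(ℝ, E 3 × ℝ) 𝓘(ℝ, ℝ) ∞ (fun x : E 3 × ℝ => 2 * Real.pi * x.2) x :=
    (contDiff_const.mul contDiff_snd).contMDiff.contMDiffAt
  have h3 : ContMDiffAt 𝓘(ℝ, E 3 × ℝ) (𝓡 1) ∞
      (fun x : E 3 × ℝ => Circle.exp (2 * Real.pi * x.2) * z) x :=
    ContMDiffAt.mul ((contMDiff_circleExp (m := ∞) _).comp x h2) contMDiffAt_const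
  have h4 : e.target ∈ 𝓝 (proj Γ x.1, Circle.exp (2 * Real.pi * x.2) * z) :=
    e.open_target.mem_nhds (e.mem_target.2 hx)
  exact (((he.contMDiffOn_symm.contMDiffAt h4).comp x (h1.prodMk h3)).of_le two_le_infty)

/-- Locally `π ∘ bundleParam e z` is `proj Γ` composed with the first projection, so forms from the
base see neither the fibre coordinate nor `z`. -/
theorem along_bundleParam [IsManifold (𝓡 4) ∞ M] (hπ : IsPrincipalCircleBundle π)
    (he : IsEquivariantTrivialization e) {x : E 3 × ℝ}
    (hx : proj Γ x.1 ∈ e.baseSet) (θ : DForm 3 1 (Gk k ⧸ Γ)) (v : E 3 × ℝ) :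
    along (bundleParam e z) (pullback (m := 4) π θ) v x =
      toFunctional 3 (pullback (m := 3) (proj Γ) θ x.1) v.1 := by
  rw [along_pullback (hπ.contMDiff.mdifferentiable (by simp) _)
    ((contMDiffAt_bundleParam he hx).mdifferentiableAt (by simp))]
  have h1 : π ∘ bundleParam e z =ᶠ[𝓝 x] proj Γ ∘ Prod.fst := by
    have h2 : Continuous fun x : E 3 × ℝ => proj Γ x.1 :=
      (contMDiff_proj Γ).continuous.comp continuous_fst
    filter_upwards [h2.continuousAt.eventually (e.open_baseSet.mem_nhds hx)] with y hy
    exact e.proj_symm_apply' hy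
  have h3 : fderiv ℝ (Prod.fst : E 3 × ℝ → E 3) x v = v.1 := by
    rw [fderiv_fst]
    rfl
  rw [(along_congr (m := 3) h1 θ v).self_of_nhds]
  refine (eventually_along_proj_comp contDiff_fst.contDiffAt θ v).self_of_nhds.trans ?_
  exact congrArg (toFunctional 3 (pullback (m := 3) (proj Γ) θ x.1)) h3

theorem along_bundleParam_vertical (hπ : IsPrincipalCircleBundle π)
    (he : IsEquivariantTrivialization e) {η : DForm 4 1 M} (hη : IsConnectionForm η)
    {x : E 3 × ℝ} (hx : proj Γ x.1 ∈ e.baseSet) :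
    along (bundleParam e z) η (0, 1) x = 1 := by
  set l : ℝ → E 3 × ℝ := fun t => (x.1, x.2 + t) with hl
  have hl' : HasFDerivAt l (ContinuousLinearMap.inr ℝ (E 3) ℝ) 0 :=
    (hasFDerivAt_const x.1 (0 : ℝ)).prodMk ((hasFDerivAt_id (𝕜 := ℝ) (0 : ℝ)).const_add x.2)
  have hl0 : l 0 = x := by simp [hl]
  -- By equivariance the fibre coordinate runs along the orbit curve on which the connection form is
  -- normalized.
  have h1 : bundleParam e z ∘ l = fun t : ℝ => Circle.exp (2 * Real.pi * t) • bundleParam e z x := by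
    funext t
    change bundleParam e z (x.1, x.2 + t) = _
    simp only [bundleParam]
    rw [trivialization_smul hπ he hx, mul_add, add_comm, Circle.exp_add, mul_assoc]
  have h2 := dAlong_comp_right (m := 4) (Φ := bundleParam e z) (i := l) (y := 0)
    (by rw [hl0]; exact (contMDiffAt_bundleParam he hx).mdifferentiableAt (by simp)) hl' 1
  have h3 : along (bundleParam e z ∘ l) η 1 0 = along (bundleParam e z) η (0, 1) (l 0) := by
    simp only [along]
    rw [h2]
    rfl
  rw [hl0, h1] at h3
  rw [← h3]
  exact hη.vertical (bundleParam e z x)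

end CircleBundle

/-- Exchanging `a` and `b` interchanges their structure equations up to the sign of `k` and turns
`a∧b` into `-b∧a`. The product `r k` in the nondegeneracy condition is unchanged, so `Ω'` becomes a
case of `Ω`. -/
theorem IsLcsCoframe.swap {M : Type*} [TopologicalSpace M] [ChartedSpace (E 4) M] {k r : ℝ}
    {a b c e : DForm 4 1 M} (h : IsLcsCoframe k r a b c e) : IsLcsCoframe (-k) (-r) b a c e where
  da := by
    rw [neg_neg]
    exact h.db
  db := h.da
  dc := h.dc
  de := by
    convert h.de using 1
    funext p
    ext v
    change -r * (b p (fun _ => v 0) * a p (fun _ => v 1) - b p (fun _ => v 1) * a p (fun _ => v 0)) =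
      r * (a p (fun _ => v 0) * b p (fun _ => v 1) - a p (fun _ => v 1) * b p (fun _ => v 0))
    ring
  exists_dual p := by
    obtain ⟨A, B, C, T, hA, hB, hC, hT⟩ := h.exists_dual p
    exact ⟨B, A, C, T, ⟨hB.2.1, hB.1, hB.2.2⟩, ⟨hA.2.1, hA.1, hA.2.2⟩, ⟨hC.2.1, hC.1, hC.2.2⟩,
      ⟨hT.2.1, hT.1, hT.2.2⟩⟩

section CircleBundle

variable {k : ℝ} {Γ : Subgroup (Gk k)} [DiscreteTopology Γ]
  {M : Type*} [TopologicalSpace M] [ChartedSpace (E 4) M]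
  [MulAction Circle M] {π : M → Gk k ⧸ Γ}

theorem IsPrincipalCircleBundle.exists_equivariant
    (hπ : IsPrincipalCircleBundle π) (b : Gk k ⧸ Γ) :
    ∃ e : Bundle.Trivialization Circle π, b ∈ e.baseSet ∧ IsEquivariantTrivialization e := by
  obtain ⟨e, h1, -, h2, h3⟩ := hπ.locally_trivial b
  exact ⟨e, h1, h2, h3⟩

/-- The lift of the flow `s ↦ s • D` to a circle bundle. -/
theorem exists_flow_lift [IsManifold (𝓡 4) ∞ M] (hπ : IsPrincipalCircleBundle π) {η : DForm 4 1 M}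
    (hη : IsConnectionForm η) (D : E 3) : ∃ P : ℝ → M, ∀ s₀ : ℝ, ∃ ε > 0, ∃ F : ℝ × ℝ → M,
      (∀ s t, F (s, t + 1) = F (s, t)) ∧ ∀ s ∈ Metric.ball s₀ ε,
        (∀ t, ContMDiffAt 𝓘(ℝ, ℝ × ℝ) (𝓡 4) 2 F (s, t) ∧
          (∀ θ : DForm 3 1 (Gk k ⧸ Γ), along F (pullback (m := 4) π θ) (1, 0) (s, t) =
            toFunctional 3 (pullback (m := 3) (proj Γ) θ (s • D)) D ∧
            along F (pullback (m := 4) π θ) (0, 1) (s, t) = 0) ∧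
          along F η (0, 1) (s, t) = 1) ∧
        ∃ z : Circle, ∀ t, F (s, t) = (Circle.exp (2 * Real.pi * t) * z) • P s := by
  have hsurj : ∀ b, ∃ p, π p = b := fun b => by
    obtain ⟨e, he, -⟩ := hπ.exists_equivariant b
    exact ⟨_, e.proj_symm_apply' (x := (1 : Circle)) he⟩
  choose σ hσ using hsurj
  have hline : Continuous fun s : ℝ => proj Γ (s • D) :=
    (contMDiff_proj Γ).continuous.comp (by fun_prop)
  refine ⟨fun s => σ (proj Γ (s • D)), fun s₀ => ?_⟩
  obtain ⟨e, he₀, he⟩ := hπ.exists_equivariant (proj Γ (s₀ • D))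
  obtain ⟨ε, hε, hball⟩ := Metric.isOpen_iff.1 (e.open_baseSet.preimage hline) s₀ he₀
  set i : ℝ × ℝ → E 3 × ℝ := fun x => (x.1 • D, x.2) with hi
  have hi' : ∀ x, HasFDerivAt i
      (((ContinuousLinearMap.fst ℝ ℝ ℝ).smulRight D).prod (ContinuousLinearMap.snd ℝ ℝ ℝ)) x :=
    fun x => ((hasFDerivAt_fst (𝕜 := ℝ)).smul_const D).prodMk (hasFDerivAt_snd (𝕜 := ℝ))
  have hiC : ContDiff ℝ 2 i := (contDiff_fst.smul contDiff_const).prodMk contDiff_snd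
  refine ⟨ε, hε, bundleParam e 1 ∘ i, fun s t => ?_, fun s hs => ⟨fun t => ?_, ?_⟩⟩
  · simp only [Function.comp, hi, bundleParam, mul_add, mul_one, Circle.exp_add, Circle.exp_two_pi]
  · have hb : proj Γ (i (s, t)).1 ∈ e.baseSet := hball hs
    have hC := contMDiffAt_bundleParam (z := 1) he hb
    have hd := fun v => dAlong_comp_right (m := 4) (hC.mdifferentiableAt (by simp)) (hi' (s, t)) v
    have hal : ∀ (θ : DForm 4 1 M) (v : ℝ × ℝ), along (bundleParam e 1 ∘ i) θ v (s, t) =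
        along (bundleParam e 1) θ (v.1 • D, v.2) (i (s, t)) := fun θ v => by
      simp only [along]
      rw [hd]
      rfl
    refine ⟨hC.comp (s, t) hiC.contMDiff.contMDiffAt, fun θ => ⟨?_, ?_⟩, ?_⟩
    · rw [hal, along_bundleParam hπ he hb]
      exact congrArg _ (one_smul ℝ D)
    · rw [hal, along_bundleParam hπ he hb]
      refine (congrArg _ (zero_smul ℝ D)).trans ?_
      exact (toFunctional 3 (pullback (m := 3) (proj Γ) θ (s • D))).map_zero
    · rw [hal]
      simp only [zero_smul]
      exact along_bundleParam_vertical hπ he hη hb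
  · have hb : proj Γ (s • D) ∈ e.baseSet := hball hs
    have hsrc : σ (proj Γ (s • D)) ∈ e.source := e.mem_source.2 (by rwa [hσ])
    have h1 := e.symm_apply_mk_proj hsrc
    rw [hσ] at h1
    -- The strip starts at fibre coordinate `1`; this rotation takes the chosen point of the fibre
    -- to that one.
    refine ⟨(e (σ (proj Γ (s • D)))).2⁻¹, fun t => ?_⟩
    have h2 := trivialization_smul hπ he hb
      (Circle.exp (2 * Real.pi * t) * (e (σ (proj Γ (s • D)))).2⁻¹) (e (σ (proj Γ (s • D)))).2
    rw [h1] at h2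
    refine Eq.trans ?_ h2.symm
    simp [bundleParam, hi]

theorem exists_dual_frame [IsManifold (𝓡 4) ∞ M] (hπ : IsPrincipalCircleBundle π) {η : DForm 4 1 M}
    (hη : IsConnectionForm η) (p : M) : ∃ L : E 3 →ₗ[ℝ] TangentSpace (𝓡 4) p,
      ∃ T : TangentSpace (𝓡 4) p, ∃ v₀ : E 3,
      (∀ θ : DForm 3 1 (Gk k ⧸ Γ),
        (∀ w, pullback (m := 4) π θ p (fun _ => L w) =
          toFunctional 3 (pullback (m := 3) (proj Γ) θ v₀) w) ∧
        pullback (m := 4) π θ p (fun _ => T) = 0) ∧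
      η p (fun _ => T) = 1 := by
  obtain ⟨e, he₀, he⟩ := hπ.exists_equivariant (π p)
  obtain ⟨v₀, hv₀⟩ := proj_surjective Γ (π p)
  have hb : proj Γ (v₀, (0 : ℝ)).1 ∈ e.baseSet := by rwa [hv₀]
  -- Taking `z` to be the fibre coordinate of `p` makes the parametrization pass through `p` at
  -- fibre parameter `0`.
  have hp : bundleParam e (e p).2 (v₀, 0) = p := by
    simp only [bundleParam, mul_zero, Circle.exp_zero, one_mul]
    rw [hv₀]
    exact e.symm_apply_mk_proj (e.mem_source.2 he₀)
  rw [← hp]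
  refine ⟨((dAlong (m := 4) (bundleParam e (e p).2) (v₀, (0 : ℝ))).comp
      (ContinuousLinearMap.inl ℝ (E 3) ℝ)).toLinearMap,
    dAlong (m := 4) (bundleParam e (e p).2) (v₀, (0 : ℝ)) (0, 1), v₀, fun θ => ⟨fun w => ?_, ?_⟩, ?_⟩
  · exact along_bundleParam hπ he hb θ (w, 0)
  · refine (along_bundleParam hπ he hb θ (0, 1)).trans ?_
    exact (toFunctional 3 (pullback (m := 3) (proj Γ) θ v₀)).map_zero
  · exact along_bundleParam_vertical hπ he hη hb

theorem isLcsCoframe_of_curvature [IsManifold (𝓡 4) ∞ M] (hπ : IsPrincipalCircleBundle π) {η : DForm 4 1 M}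
    (hη : IsConnectionForm η) {r : ℝ}
    (hcurv : extD η = r • pullback (m := 4) π (wedge (alpha Γ) (beta Γ))) :
    IsLcsCoframe k r (pullback (m := 4) π (alpha Γ)) (pullback (m := 4) π (beta Γ))
      (pullback (m := 4) π (gamma Γ)) η := by
  have hC : ContMDiff (𝓡 4) (𝓡 3) 2 π := hπ.contMDiff.of_le two_le_infty
  refine ⟨hasExtD_pullback hC (hasExtD_alpha Γ), hasExtD_pullback hC (hasExtD_beta Γ),
    hasExtD_pullback hC (hasExtD_gamma Γ), ?_, fun p => ?_⟩
  · have h := hη.smooth.hasExtD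
    rwa [hcurv] at h
  · obtain ⟨L, T, v₀, hLT, hT⟩ := exists_dual_frame hπ hη p
    have hα : ∀ w : E 3, pullback (m := 4) π (alpha Γ) p (fun _ => L w) = w 0 - k * v₀ 0 * w 2 :=
      fun w => by
        rw [(hLT (alpha Γ)).1 w, pullback_alpha]
        rfl
    have hβ : ∀ w : E 3, pullback (m := 4) π (beta Γ) p (fun _ => L w) = w 1 + k * v₀ 1 * w 2 :=
      fun w => by
        rw [(hLT (beta Γ)).1 w, pullback_beta]
        rfl
    have hγ : ∀ w : E 3, pullback (m := 4) π (gamma Γ) p (fun _ => L w) = w 2 :=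
      fun w => by
        rw [(hLT (gamma Γ)).1 w, pullback_gamma]
        rfl
    have hsub : ∀ (θ : DForm 4 1 M) (x : TangentSpace (𝓡 4) p) (s : ℝ),
        θ p (fun _ => x + s • T) = θ p (fun _ => x) + s * θ p (fun _ => T) := fun θ x s => by
      rw [alt_one_add, alt_one_smul]
    have hTα := (hLT (alpha Γ)).2
    have hTβ := (hLT (beta Γ)).2
    have hTγ := (hLT (gamma Γ)).2
    -- The vectors `∂_x`, `∂_y` and `k x ∂_x - k y ∂_y + ∂_z` are dual to `dx - k x dz`, `dy + k y
    -- dz`, `dz`. Subtracting multiples of `T` makes their lifts horizontal for `η`.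
    refine ⟨L !₂[1, 0, 0] + (-η p (fun _ => L !₂[1, 0, 0])) • T,
      L !₂[0, 1, 0] + (-η p (fun _ => L !₂[0, 1, 0])) • T,
      L !₂[k * v₀ 0, -(k * v₀ 1), 1] + (-η p (fun _ => L !₂[k * v₀ 0, -(k * v₀ 1), 1])) • T, T,
      ?_, ?_, ?_, hTα, hTβ, hTγ, hT⟩
    all_goals
      simp only [hsub, hα, hβ, hγ, hTα, hTβ, hTγ, hT]
      simp

/-- The function `z` on `G_k` descends locally to a primitive of `γ`. -/
theorem exists_primitive_gamma [IsManifold (𝓡 4) ∞ M] (hπ : IsPrincipalCircleBundle π) : ∃ (z : M → ℝ) (U : Set M),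
    IsOpen U ∧ IsPrimitiveOn z (pullback (m := 4) π (gamma Γ)) U ∧ ¬ (z '' U).Countable := by
  set ch := chartAt (E 3) (proj Γ 0)
  have hat : ch ∈ atlas (E 3) (Gk k ⧸ Γ) := chart_mem_atlas _ _
  have hCh : ∀ b ∈ ch.source, ContMDiffAt (𝓡 3) (𝓡 3) 2 ch b := fun b hb =>
    (contMDiffAt_of_mem_maximalAtlas (I := 𝓡 3) (n := ∞)
      (IsManifold.chart_mem_maximalAtlas _) hb).of_le two_le_infty
  have hπC : ContMDiff (𝓡 4) (𝓡 3) 2 π := hπ.contMDiff.of_le two_le_infty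
  refine ⟨fun p => ch (π p) 2, π ⁻¹' ch.source, ch.open_source.preimage hπC.continuous, ?_, ?_⟩
  · intro V _ _ F x hF hx
    have hφ : ContDiffAt ℝ 2 (ch ∘ (π ∘ F)) x :=
      ((hCh _ hx).comp x ((hπC _).comp x hF)).contDiffAt
    have hev : π ∘ F =ᶠ[𝓝 x] proj Γ ∘ (ch ∘ (π ∘ F)) := by
      have hc : ContinuousAt (π ∘ F) x := ((hπC _).comp x hF).continuousAt
      filter_upwards [hc.eventually (ch.open_source.mem_nhds hx)] with y hy
      have hy' : π (F y) ∈ ch.source := hy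
      have := hat (ch (π (F y))) (ch.map_source hy')
      rwa [ch.left_inv hy'] at this
    have hd : HasFDerivAt ((fun p => ch (π p) 2) ∘ F)
        ((EuclideanSpace.proj 2 : E 3 →L[ℝ] ℝ).comp (fderiv ℝ (ch ∘ (π ∘ F)) x)) x :=
      (EuclideanSpace.proj 2 : E 3 →L[ℝ] ℝ).hasFDerivAt.comp x
        (hφ.differentiableAt (by simp)).hasFDerivAt
    refine ⟨hd.differentiableAt, fun v => ?_⟩
    rw [hd.fderiv, (eventually_along_pullback (hπC.mdifferentiable (by simp)) hF _ v).self_of_nhds,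
      (along_congr (m := 3) hev _ v).self_of_nhds]
    refine Eq.trans ?_ (eventually_along_proj_comp hφ (gamma Γ) v).self_of_nhds.symm
    rw [pullback_gamma]
    rfl
  · intro hcount
    set y := ch (proj Γ 0)
    have hy : y ∈ ch.target := mem_chart_target _ _
    have hl : Continuous fun s : ℝ => y + s • (EuclideanSpace.single 2 1 : E 3) := by fun_prop
    have hopen : IsOpen ((fun s : ℝ => y + s • (EuclideanSpace.single 2 1 : E 3)) ⁻¹' ch.target) :=
      ch.open_target.preimage hl
    have hne : ((fun s : ℝ => y + s • (EuclideanSpace.single 2 1 : E 3)) ⁻¹' ch.target).Nonempty :=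
      ⟨0, by simpa using hy⟩
    -- Moving in the `z`-direction inside the chart, and picking any point of the fibre above,
    -- realizes an open set of values.
    have hsub : (fun s => y 2 + s) ''
        ((fun s : ℝ => y + s • (EuclideanSpace.single 2 1 : E 3)) ⁻¹' ch.target) ⊆
          (fun p => ch (π p) 2) '' (π ⁻¹' ch.source) := by
      rintro _ ⟨s, hs, rfl⟩
      have hs' : y + s • (EuclideanSpace.single 2 1 : E 3) ∈ ch.target := hs
      obtain ⟨e, he, -⟩ := hπ.exists_equivariant
        (ch.symm (y + s • (EuclideanSpace.single 2 1 : E 3)))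
      have hpe := e.proj_symm_apply' (x := (1 : Circle)) he
      refine ⟨e.toOpenPartialHomeomorph.symm
        (ch.symm (y + s • (EuclideanSpace.single 2 1 : E 3)), (1 : Circle)), ?_, ?_⟩
      · rw [mem_preimage, hpe]
        exact ch.map_target hs'
      · simp only [hpe, ch.right_inv hs']
        simp
    have h1 := (hcount.mono hsub).preimage (add_right_injective (y 2))
    rw [preimage_image_eq _ (add_right_injective (y 2))] at h1
    -- The set of admissible `s` would be countable, hence of measure zero, although it is open and
    -- nonempty.
    exact (hopen.measure_pos MeasureTheory.volume hne).ne' (h1.measure_zero _)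

end CircleBundle

/-! ### The contradiction, and the two families of forms -/

/-- A transitive action cannot preserve `t₁ a∧e + t₂ b∧c + t₃ (r a∧b - k c∧e)`. -/
theorem IsLcsCoframe.not_invariant {k : ℝ} {Γ : Subgroup (Gk k)} [DiscreteTopology Γ]
    [CompactSpace (Gk k ⧸ Γ)] {M : Type*} [TopologicalSpace M] [ChartedSpace (E 4) M]
    [IsManifold (𝓡 4) ∞ M] [MulAction Circle M] {π : M → Gk k ⧸ Γ}
    (hπ : IsPrincipalCircleBundle π) {d : ℕ} {G : Type*} [Group G] [TopologicalSpace G]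
    [ChartedSpace (E d) G] [LieGroup (𝓡 d) ∞ G] [SecondCountableTopology G] [MulAction G M]
    [ContMDiffSMul (𝓡 d) (𝓡 4) ∞ G M] [MulAction.IsPretransitive G M]
    {k' r : ℝ} {a b e : DForm 4 1 M} (h : IsLcsCoframe k' r a b (pullback (m := 4) π (gamma Γ)) e)
    (hk : k' ≠ 0)
    (hP : ∃ P : ℝ → M, ∀ s₀ : ℝ, ∃ ε > 0, ∃ F : ℝ × ℝ → M, (∀ s t, F (s, t + 1) = F (s, t)) ∧
      ∀ s ∈ Metric.ball s₀ ε, IsFlowStrip a b (pullback (m := 4) π (gamma Γ)) e F s ∧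
        ∃ z : Circle, ∀ t, F (s, t) = (Circle.exp (2 * Real.pi * t) * z) • P s)
    {t₁ t₂ t₃ : ℝ} (ht : t₁ * t₂ ≠ 0) (ht' : t₁ * t₂ ≠ r * k' * t₃ ^ 2) :
    ¬ ∀ q : G, pullback (m := 4) (fun p : M => q • p)
        (lcsForm k' r a b (pullback (m := 4) π (gamma Γ)) e t₁ t₂ t₃) =
      lcsForm k' r a b (pullback (m := 4) π (gamma Γ)) e t₁ t₂ t₃ := by
  intro hΩ
  have htriv : ∀ b, ∃ e : Bundle.Trivialization Circle π, b ∈ e.baseSet := fun b =>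
    let ⟨e, he, _⟩ := hπ.exists_equivariant b
    ⟨e, he⟩
  have : LocallyCompactSpace (Gk k ⧸ Γ) := ChartedSpace.locallyCompactSpace (E 3) _
  have : CompactSpace M := compactSpace_of_circleBundle htriv
  have : PreconnectedSpace M := preconnectedSpace_of_circleBundle
    (contMDiff_proj Γ).continuous (proj_surjective Γ) htriv
  have hc := fun q : G => h.pullback_lee hk ht ht' (contMDiff_smul_two d q) (hΩ q)
  obtain ⟨P, hP⟩ := hP
  obtain ⟨z, U, hU, hz, hcount⟩ := exists_primitive_gamma hπ
  exact hcount (countable_image_primitive (d := d) (p := P 0) hc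
    (fun g hg hg0 => h.flowVal_lee_eq_zero hk ht ht' hΩ hP hg hg0 (P 0)) hU hz)

theorem lcsForm_swap {M : Type*} [TopologicalSpace M] [ChartedSpace (E 4) M] (k r : ℝ)
    (a b c e : DForm 4 1 M) (s₁ s₂ s₃ : ℝ) : lcsForm (-k) (-r) b a c e s₁ s₂ s₃ =
      s₁ • wedge b e + s₂ • wedge a c + s₃ • (r • wedge a b + k • wedge c e) := by
  funext p
  ext v
  have h : wedge b a p v = -wedge a b p v := by
    change b p (fun _ => v 0) * a p (fun _ => v 1) - b p (fun _ => v 1) * a p (fun _ => v 0) =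
      -(a p (fun _ => v 0) * b p (fun _ => v 1) - a p (fun _ => v 1) * b p (fun _ => v 0))
    ring
  change s₁ * wedge b e p v + s₂ * wedge a c p v +
      s₃ * (-r * wedge b a p v - -k * wedge c e p v) =
    s₁ * wedge b e p v + s₂ * wedge a c p v + s₃ * (r * wedge a b p v + k * wedge c e p v)
  rw [h]
  ring

theorem omegaT_eq_lcsForm {k : ℝ} {Γ : Subgroup (Gk k)} [DiscreteTopology Γ] {M : Type*}
    [TopologicalSpace M] [ChartedSpace (E 4) M] (π : M → Gk k ⧸ Γ) (η : DForm 4 1 M) (n : ℤ)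
    (lam t₁ t₂ t₃ : ℝ) : OmegaT Γ n lam π η t₁ t₂ t₃ =
    lcsForm k (n * lam) (pullback (m := 4) π (alpha Γ)) (pullback (m := 4) π (beta Γ))
      (pullback (m := 4) π (gamma Γ)) η t₁ t₂ t₃ := rfl

theorem omegaS_eq_lcsForm {k : ℝ} {Γ : Subgroup (Gk k)} [DiscreteTopology Γ] {M : Type*}
    [TopologicalSpace M] [ChartedSpace (E 4) M] (π : M → Gk k ⧸ Γ) (η : DForm 4 1 M) (n : ℤ)
    (lam s₁ s₂ s₃ : ℝ) : OmegaS Γ n lam π η s₁ s₂ s₃ =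
    lcsForm (-k) (-(n * lam)) (pullback (m := 4) π (beta Γ)) (pullback (m := 4) π (alpha Γ))
      (pullback (m := 4) π (gamma Γ)) η s₁ s₂ s₃ := by
  rw [lcsForm_swap]
  rfl

section CircleBundle

variable {k : ℝ} {Γ : Subgroup (Gk k)} [DiscreteTopology Γ]
  {M : Type*} [TopologicalSpace M] [ChartedSpace (E 4) M] [IsManifold (𝓡 4) ∞ M]
  [MulAction Circle M] {π : M → Gk k ⧸ Γ} {η : DForm 4 1 M}

/-- The direction `∂_x` has no `z`-component, so the terms `k x dz` and `k y dz` vanish on it, and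
along the line `s ↦ (s, 0, 0)` it is dual to `α` modulo vertical vectors. -/
theorem exists_flowStrip_alpha (hπ : IsPrincipalCircleBundle π) (hη : IsConnectionForm η) :
    ∃ P : ℝ → M, ∀ s₀ : ℝ, ∃ ε > 0, ∃ F : ℝ × ℝ → M, (∀ s t, F (s, t + 1) = F (s, t)) ∧
      ∀ s ∈ Metric.ball s₀ ε, IsFlowStrip (pullback (m := 4) π (alpha Γ))
        (pullback (m := 4) π (beta Γ)) (pullback (m := 4) π (gamma Γ)) η F s ∧
        ∃ z : Circle, ∀ t, F (s, t) = (Circle.exp (2 * Real.pi * t) * z) • P s := by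
  obtain ⟨P, hP⟩ := exists_flow_lift hπ hη !₂[1, 0, 0]
  refine ⟨P, fun s₀ => ?_⟩
  obtain ⟨ε, hε, F, hper, hF⟩ := hP s₀
  refine ⟨ε, hε, F, hper, fun s hs => ⟨?_, (hF s hs).2⟩⟩
  have H := (hF s hs).1
  refine ⟨fun t => (H t).1, fun t => ?_, fun t => ?_, fun t => ?_, fun t => ((H t).2.1 _).2,
    fun t => ((H t).2.1 _).2, fun t => ((H t).2.1 _).2, fun t => (H t).2.2⟩
  · rw [((H t).2.1 _).1, pullback_alpha]
    change (1 : ℝ) - k * _ * 0 = 1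
    ring
  · rw [((H t).2.1 _).1, pullback_beta]
    change (0 : ℝ) + k * _ * 0 = 0
    ring
  · rw [((H t).2.1 _).1, pullback_gamma]
    rfl

theorem exists_flowStrip_beta (hπ : IsPrincipalCircleBundle π) (hη : IsConnectionForm η) :
    ∃ P : ℝ → M, ∀ s₀ : ℝ, ∃ ε > 0, ∃ F : ℝ × ℝ → M, (∀ s t, F (s, t + 1) = F (s, t)) ∧
      ∀ s ∈ Metric.ball s₀ ε, IsFlowStrip (pullback (m := 4) π (beta Γ))
        (pullback (m := 4) π (alpha Γ)) (pullback (m := 4) π (gamma Γ)) η F s ∧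
        ∃ z : Circle, ∀ t, F (s, t) = (Circle.exp (2 * Real.pi * t) * z) • P s := by
  obtain ⟨P, hP⟩ := exists_flow_lift hπ hη !₂[0, 1, 0]
  refine ⟨P, fun s₀ => ?_⟩
  obtain ⟨ε, hε, F, hper, hF⟩ := hP s₀
  refine ⟨ε, hε, F, hper, fun s hs => ⟨?_, (hF s hs).2⟩⟩
  have H := (hF s hs).1
  refine ⟨fun t => (H t).1, fun t => ?_, fun t => ?_, fun t => ?_, fun t => ((H t).2.1 _).2,
    fun t => ((H t).2.1 _).2, fun t => ((H t).2.1 _).2, fun t => (H t).2.2⟩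
  · rw [((H t).2.1 _).1, pullback_beta]
    change (1 : ℝ) + k * _ * 0 = 1
    ring
  · rw [((H t).2.1 _).1, pullback_alpha]
    change (0 : ℝ) - k * _ * 0 = 0
    ring
  · rw [((H t).2.1 _).1, pullback_gamma]
    rfl

end CircleBundle

end ACFM

theorem corollary2
    -- the parameter `k`, with `e^k + e^{-k} ∈ ℤ - {2}`
    (k : ℝ) (hk : ∃ j : ℤ, Real.exp k + Real.exp (-k) = j ∧ j ≠ 2)
    -- a discrete cocompact subgroup `Γ` of `G_k`; `N_k = G_k / Γ`
    (Γ : Subgroup (ACFM.Gk k)) [DiscreteTopology Γ] [CompactSpace (ACFM.Gk k ⧸ Γ)]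
    (n : ℤ) (hn : n ≠ 0) (lam : ℝ)
    -- the principal circle bundle `π : M → N_k`, with a connection form `η`
    -- such that `dη = nλ α∧β`
    {M : Type*} [TopologicalSpace M] [ChartedSpace (EuclideanSpace ℝ (Fin 4)) M]
    [IsManifold (𝓡 4) ∞ M] [MulAction Circle M]
    (π : M → ACFM.Gk k ⧸ Γ) (hπ : ACFM.IsPrincipalCircleBundle π)
    (η : ACFM.DForm 4 1 M) (hη : ACFM.IsConnectionForm η)
    (hcurv : ACFM.extD η =
      ((n : ℝ) * lam) • ACFM.pullback π (ACFM.wedge (ACFM.alpha Γ) (ACFM.beta Γ)))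
    -- a Lie group `G` with a smooth transitive action on `M`
    {d : ℕ} {G : Type*} [Group G] [TopologicalSpace G] [ChartedSpace (EuclideanSpace ℝ (Fin d)) G]
    [LieGroup (𝓡 d) ∞ G] [SecondCountableTopology G]
    [MulAction G M] [ContMDiffSMul (𝓡 d) (𝓡 4) ∞ G M] [MulAction.IsPretransitive G M] :
    (∀ t₁ t₂ t₃ : ℝ, t₁ * t₂ ≠ 0 → t₁ * t₂ ≠ n * k * lam * t₃ ^ 2 →
      ¬ ∀ g : G, ACFM.pullback (fun p : M => g • p) (ACFM.OmegaT Γ n lam π η t₁ t₂ t₃) =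
        ACFM.OmegaT Γ n lam π η t₁ t₂ t₃) ∧
    (∀ s₁ s₂ s₃ : ℝ, s₁ * s₂ ≠ 0 → s₁ * s₂ ≠ n * k * lam * s₃ ^ 2 →
      ¬ ∀ g : G, ACFM.pullback (fun p : M => g • p) (ACFM.OmegaS Γ n lam π η s₁ s₂ s₃) =
        ACFM.OmegaS Γ n lam π η s₁ s₂ s₃) := by
  -- For `k = 0` the sum `e^k + e^{-k}` would be the excluded value `2`.
  have hk0 : k ≠ 0 := by
    rintro rfl
    obtain ⟨j, hj, hj2⟩ := hk
    refine hj2 (Int.cast_injective (α := ℝ) ?_)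
    rw [← hj]
    norm_num
  have hframe := ACFM.isLcsCoframe_of_curvature hπ hη hcurv
  refine ⟨fun t₁ t₂ t₃ ht ht' => ?_, fun s₁ s₂ s₃ hs hs' => ?_⟩
  · rw [ACFM.omegaT_eq_lcsForm]
    refine hframe.not_invariant (d := d) hπ hk0 (ACFM.exists_flowStrip_alpha hπ hη) ht fun h => ?_
    exact ht' (h.trans (by ring))
  · rw [ACFM.omegaS_eq_lcsForm]
    refine hframe.swap.not_invariant (d := d) hπ (neg_ne_zero.2 hk0)
      (ACFM.exists_flowStrip_beta hπ hη) hs fun h => ?_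
    exact hs' (h.trans (by ring))
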